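/- Let $n\in\mathbb N$ and let $f:\mathbb R^n\to\mathbb R$. By an entire solution of $$\operatorname{div}\left(\frac{\nabla u}{\sqrt{1+|\nabla u|^2}}\right)=f(\nabla u)\quad\text{in }\mathbb R^n \qquad (*)$$ we mean a function $u:\mathbb R^n\to\mathbb R$ with $u\in C^1(\mathbb R^n)\cap C^3(\{x\in\mathbb R^n:\nabla u(x)\neq 0\})$ that satisfies $(*)$ at every point $x$ with $\nabla u(x)\ne 0$ (nothing is required at critical points of $u$, where $u$ need not be twice differentiable). Every entire solution $u$ of $(*)$ is constant in each of the following cases: (E1) $f(p)=|p|^\theta$ with $\theta>0$; (E2) $f(p)=\bigl(\log(1+|p|^2)\bigr)^\theta$ with $\theta>1$; (E3) $f(p)=\bigl(\log(1+|p|^2)\bigr)^\theta$ with $0<\theta\le 1$, provided $u(x)=o(|x|^2)$ as $|x|\to\infty$; (E4) $f(p)=\dfrac{|p|}{\sqrt{1+|p|^2}}$, provided $u(x)=o(|x|^{1/3})$ as $|x|\to\infty$. -/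

import Mathlib

noncomputable section

/-- The Euclidean divergence `∑ i, ∂ᵢ Vᵢ` of a vector field on `ℝⁿ` at the point `x`. -/
def euclideanDiv {n : ℕ} (V : EuclideanSpace ℝ (Fin n) → EuclideanSpace ℝ (Fin n))
    (x : EuclideanSpace ℝ (Fin n)) : ℝ :=
  ∑ i : Fin n, (fderiv ℝ V x (EuclideanSpace.single i 1)) i

/-- The mean curvature operator `div (∇u / √(1 + |∇u|²))` at the point `x`. -/
def meanCurvatureOp {n : ℕ} (u : EuclideanSpace ℝ (Fin n) → ℝ)
    (x : EuclideanSpace ℝ (Fin n)) : ℝ :=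
  euclideanDiv (fun y => (Real.sqrt (1 + ‖gradient u y‖ ^ 2))⁻¹ • gradient u y) x

/-- `u` is an entire solution of `div (∇u / √(1 + |∇u|²)) = f(∇u)` on `ℝⁿ`: it is `C¹` on `ℝⁿ`,
`C³` on the (open) set where the gradient does not vanish, and satisfies the equation there.
Nothing is required at critical points, where `u` need not have second derivatives; classical
solutions, and weak solutions of this regularity, are solutions in this sense. -/
structure IsEntireSolution {n : ℕ} (f : EuclideanSpace ℝ (Fin n) → ℝ)
    (u : EuclideanSpace ℝ (Fin n) → ℝ) : Prop where
  contDiff_one : ContDiff ℝ 1 u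
  contDiffOn_three : ContDiffOn ℝ 3 u {x | gradient u x ≠ 0}
  equation : ∀ x, gradient u x ≠ 0 → meanCurvatureOp u x = f (gradient u x)

end

/-! Expanding the divergence turns the equation into `ellOp (∇u) (D²u) = √(1+|∇u|²) f(∇u)`, with
`ellOp` elliptic. At an interior maximum of an auxiliary function `P`, the gradient of `P` vanishes
and `ellOp` of its Hessian is nonpositive. Every case plays this against the equation; the point
used always has nonzero gradient, so `u` is smooth enough there.

For (E1)-(E3) write `l = log (1+|∇u|²)` and `f = F(l)`. Differentiating the equation along `∇u` and
bounding the Hessian norm below by its trace gives `bernstein_inequality`, hence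
`IsEntireSolution.bernstein`: `ellOp (D²l)` is at least `F²/n` plus a drift term linear in `∇l`.

If `F` dominates `l^κ` with `κ > 1`, then `-l^(1-κ)` is bounded above even where `l` is large.
Penalising it by a multiple of `|x-x₀|²/R²` gives a maximum point at which every error is `O(F²/R)`,
against `F²/n`; large `R` is impossible. This is `gradient_eq_zero_of_superlinear`, covering (E1)
and (E2).

For (E3) the growth of `F` is too weak, so `-λu` with `λ` of order `R⁻²` is added to `l`, together
with a logarithmic cutoff. The drift then produces `2λF'|∇u|²/√(1+|∇u|²)`, nearly of size `λ
exp(l/2)`, while the cutoff errors are at most of order `R⁻² exp(l/4)`. Subquadratic growth keeps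
`λu` small although `λR²` is large.

(E4) needs no gradient estimate: `u` is compared with small multiples of a radial strict
supersolution (`barrier_real_inequality`). This gives `u x₁ ≤ u x₀` for all pairs of points, and
only `o(|x|²)` growth is needed. -/

open Topology Filter InnerProductSpace

/-! ### Linear algebra of the coefficient matrix. -/

section LinearAlgebra

variable {ι E : Type*} [Fintype ι] [NormedAddCommGroup E] [InnerProductSpace ℝ E]

/-- The trace of a bilinear form `B` against the matrix `I - p ⊗ p / (1 + |p|²)`. -/
noncomputable def ellOp (b : OrthonormalBasis ι ℝ E) (p : E) (B : E →L[ℝ] E →L[ℝ] ℝ) : ℝ :=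
  ∑ i, B (b i) (b i) - B p p / (1 + ‖p‖ ^ 2)

theorem ellOp_add (b : OrthonormalBasis ι ℝ E) (p : E) (B C : E →L[ℝ] E →L[ℝ] ℝ) :
    ellOp b p (B + C) = ellOp b p B + ellOp b p C := by
  simp only [ellOp, add_apply, Finset.sum_add_distrib]
  ring

theorem ellOp_smul (b : OrthonormalBasis ι ℝ E) (p : E) (c : ℝ) (B : E →L[ℝ] E →L[ℝ] ℝ) :
    ellOp b p (c • B) = c * ellOp b p B := by
  simp only [ellOp, smul_apply, smul_eq_mul, ← Finset.mul_sum]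
  ring

theorem OrthonormalBasis.sum_inner_mul_apply (b : OrthonormalBasis ι ℝ E) (p : E)
    (d : E →L[ℝ] ℝ) : ∑ i, inner ℝ (b i) p * d (b i) = d p := by
  conv_rhs => rw [← b.sum_repr' p]
  simp

theorem OrthonormalBasis.sum_inner_sq (b : OrthonormalBasis ι ℝ E) (p : E) :
    ∑ i, inner ℝ (b i) p ^ 2 = ‖p‖ ^ 2 := by
  simpa using b.sum_sq_norm_inner_right p

/-- The matrix `I - p⊗p/(1+|p|²)` is the square of `A = I - c p⊗p`, so `ellOp` is the sum of `B (A
bᵢ) (A bᵢ)`. On `p` the root `A` has eigenvalue `1/√(1+|p|²)`, which determines `c`. Symmetry of `B`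
plays no role. -/
theorem ellOp_nonpos (b : OrthonormalBasis ι ℝ E) (p : E) {B : E →L[ℝ] E →L[ℝ] ℝ}
    (hB : ∀ v, B v v ≤ 0) : ellOp b p B ≤ 0 := by
  obtain ⟨c, hc⟩ : ∃ c : ℝ, 2 * c - c ^ 2 * ‖p‖ ^ 2 = 1 / (1 + ‖p‖ ^ 2) := by
    set s := Real.sqrt (1 + ‖p‖ ^ 2) with hs
    have h1 : s ^ 2 = 1 + ‖p‖ ^ 2 := Real.sq_sqrt (by positivity)
    have hs0 : 0 < s := Real.sqrt_pos.2 (by positivity)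
    refine ⟨1 / (s * (s + 1)), ?_⟩
    have h2 : ‖p‖ ^ 2 = s ^ 2 - 1 := by linarith
    rw [← h1, h2]
    field_simp
    ring
  have key : ∑ i, B (b i - (c * inner ℝ (b i) p) • p) (b i - (c * inner ℝ (b i) p) • p)
      = ellOp b p B := by
    have e : ∀ i, B (b i - (c * inner ℝ (b i) p) • p) (b i - (c * inner ℝ (b i) p) • p)
        = B (b i) (b i) - c * (inner ℝ (b i) p * (B.flip p) (b i))
          - c * (inner ℝ (b i) p * (B p) (b i)) + c ^ 2 * B p p * inner ℝ (b i) p ^ 2 := by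
      intro i
      simp only [map_sub, map_smul, sub_apply, smul_apply,
        smul_eq_mul, ContinuousLinearMap.flip_apply]
      ring
    simp only [e, Finset.sum_add_distrib, Finset.sum_sub_distrib, ← Finset.mul_sum,
      b.sum_inner_mul_apply, b.sum_inner_sq]
    rw [ContinuousLinearMap.flip_apply, ellOp, div_eq_mul_one_div, ← hc]
    ring
  rw [← key]
  exact Finset.sum_nonpos fun i _ => hB _

/-- Lower bound for the Frobenius norm of a matrix, separating the direction `p`. -/
theorem sum_norm_sq_apply_ge (b : OrthonormalBasis ι ℝ E) {p : E} (hp : p ≠ 0) (H : E →L[ℝ] E) :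
    ‖H p‖ ^ 2 / ‖p‖ ^ 2 + (∑ i, inner ℝ (H (b i)) (b i) - inner ℝ (H p) p / ‖p‖ ^ 2) ^ 2
      / Fintype.card ι ≤ ∑ i, ‖H (b i)‖ ^ 2 := by
  have hw : 0 < ‖p‖ ^ 2 := by positivity
  -- `M` is `H` composed with the projection orthogonal to `p`. Its squared Frobenius norm is that
  -- of `H` minus exactly `‖H p‖²/‖p‖²`, and Cauchy-Schwarz bounds it below by the squared trace
  -- over the dimension.
  set M : ι → E := fun i => H (b i) - (inner ℝ (b i) p / ‖p‖ ^ 2) • H p with hM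
  have h1 : ∑ i, ‖M i‖ ^ 2 = ∑ i, ‖H (b i)‖ ^ 2 - ‖H p‖ ^ 2 / ‖p‖ ^ 2 := by
    have e : ∀ i, ‖M i‖ ^ 2 = ‖H (b i)‖ ^ 2
        - 2 / ‖p‖ ^ 2 * (inner ℝ (b i) p * ((innerSL ℝ (H p)).comp H) (b i))
        + ‖H p‖ ^ 2 / (‖p‖ ^ 2) ^ 2 * inner ℝ (b i) p ^ 2 := by
      intro i
      rw [hM, norm_sub_sq_real, norm_smul, inner_smul_right, mul_pow, Real.norm_eq_abs, sq_abs]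
      simp only [ContinuousLinearMap.comp_apply, innerSL_apply_apply]
      rw [real_inner_comm (H p) (H (b i))]
      ring
    simp only [e, Finset.sum_add_distrib, Finset.sum_sub_distrib, ← Finset.mul_sum,
      b.sum_inner_mul_apply, b.sum_inner_sq]
    simp only [ContinuousLinearMap.comp_apply, innerSL_apply_apply, real_inner_self_eq_norm_sq]
    field_simp
    ring
  have h2 : ∑ i, inner ℝ (M i) (b i) = ∑ i, inner ℝ (H (b i)) (b i) - inner ℝ (H p) p / ‖p‖ ^ 2 := by
    have e : ∀ i, inner ℝ (M i) (b i) = inner ℝ (H (b i)) (b i)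
        - 1 / ‖p‖ ^ 2 * (inner ℝ (b i) p * (innerSL ℝ (H p)) (b i)) := by
      intro i
      rw [hM, inner_sub_left, real_inner_smul_left]
      simp only [innerSL_apply_apply]
      ring
    simp only [e, Finset.sum_sub_distrib, ← Finset.mul_sum, b.sum_inner_mul_apply]
    simp only [innerSL_apply_apply]
    ring
  have h3 : (∑ i, inner ℝ (M i) (b i)) ^ 2 ≤ Fintype.card ι * ∑ i, ‖M i‖ ^ 2 := by
    refine sq_sum_le_card_mul_sum_sq.trans ?_
    refine mul_le_mul_of_nonneg_left (Finset.sum_le_sum fun i _ => ?_) (by positivity)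
    have := abs_real_inner_le_norm (M i) (b i)
    rw [b.norm_eq_one, mul_one] at this
    exact sq_le_sq' (by linarith [neg_abs_le (inner ℝ (M i) (b i))]) ((le_abs_self _).trans this)
  have h4 : (∑ i, inner ℝ (M i) (b i)) ^ 2 / Fintype.card ι ≤ ∑ i, ‖M i‖ ^ 2 :=
    div_le_of_le_mul₀ (by positivity) (by positivity) (by linarith)
  rw [← h2]
  linarith

end LinearAlgebra

/-! ### Calculus of second derivatives and the second-order condition at a maximum. -/

section SecondDerivative

variable {E : Type*} [NormedAddCommGroup E] [NormedSpace ℝ E]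

/-- The second derivative of a function, as a bilinear form. -/
noncomputable def hess (φ : E → ℝ) (x : E) : E →L[ℝ] E →L[ℝ] ℝ := fderiv ℝ (fderiv ℝ φ) x

theorem ContDiffAt.hasFDerivAt_hess {φ : E → ℝ} {x : E} (h : ContDiffAt ℝ 2 φ x) :
    HasFDerivAt (fderiv ℝ φ) (hess φ x) x :=
  ((h.fderiv_right (m := 1) (by norm_num)).differentiableAt (by norm_num)).hasFDerivAt

theorem ContDiffAt.eventually_hasFDerivAt {φ : E → ℝ} {x : E} (h : ContDiffAt ℝ 2 φ x) :
    ∀ᶠ y in 𝓝 x, HasFDerivAt φ (fderiv ℝ φ y) y := by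
  filter_upwards [h.eventually (by simp)] with y hy
  exact (hy.differentiableAt (by norm_num)).hasFDerivAt

theorem hess_symm {u : E → ℝ} {x : E} (hu : ContDiffAt ℝ 2 u x) (v z : E) :
    hess u x v z = hess u x z v :=
  (hu.isSymmSndFDerivAt (by simp)) v z

theorem hess_add {φ ψ : E → ℝ} {x : E} (hφ : ContDiffAt ℝ 2 φ x) (hψ : ContDiffAt ℝ 2 ψ x) :
    hess (fun y => φ y + ψ y) x = hess φ x + hess ψ x := by
  refine HasFDerivAt.fderiv ((hφ.hasFDerivAt_hess.add hψ.hasFDerivAt_hess).congr_of_eventuallyEq ?_)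
  filter_upwards [hφ.eventually_hasFDerivAt, hψ.eventually_hasFDerivAt] with y h1 h2
  exact (h1.add h2).fderiv

theorem hess_const_mul {φ : E → ℝ} {x : E} (hφ : ContDiffAt ℝ 2 φ x) (c : ℝ) :
    hess (fun y => c * φ y) x = c • hess φ x := by
  refine HasFDerivAt.fderiv ((hφ.hasFDerivAt_hess.const_smul c).congr_of_eventuallyEq ?_)
  filter_upwards [hφ.eventually_hasFDerivAt] with y h1
  exact (h1.const_mul c).fderiv

/-- Second-order chain rule. -/
theorem hess_comp {φ : E → ℝ} {x : E} (hφ : ContDiffAt ℝ 2 φ x) {G G' : ℝ → ℝ} {G'' : ℝ}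
    (hG : ∀ᶠ s in 𝓝 (φ x), HasDerivAt G (G' s) s) (hG' : HasDerivAt G' G'' (φ x)) :
    hess (fun y => G (φ y)) x
      = G' (φ x) • hess φ x + G'' • (fderiv ℝ φ x).smulRight (fderiv ℝ φ x) := by
  have hx := hφ.eventually_hasFDerivAt.self_of_nhds
  have h := (hG'.comp_hasFDerivAt x hx).smul hφ.hasFDerivAt_hess
  have h2 : fderiv ℝ (fun y => G (φ y)) =ᶠ[𝓝 x] fun y => G' (φ y) • fderiv ℝ φ y := by
    filter_upwards [hφ.eventually_hasFDerivAt, hx.continuousAt.eventually hG] with y h1 h2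
    exact (h2.comp_hasFDerivAt y h1).fderiv
  refine (HasFDerivAt.fderiv (h.congr_of_eventuallyEq h2)).trans ?_
  ext v z
  simp [mul_assoc]

theorem hess_nonpos_of_isLocalMax {φ : E → ℝ} {x : E} (hφ : ContDiffAt ℝ 2 φ x)
    (hmax : IsLocalMax φ x) (v : E) : hess φ x v v ≤ 0 := by
  by_contra! hpos
  set γ : ℝ → E := fun t => x + t • v with hγ
  have hγ0 : γ 0 = x := by simp [hγ]
  have hγd : ∀ t, HasDerivAt γ v t := fun t => by
    simpa [hγ] using ((hasDerivAt_id t).smul_const v).const_add x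
  have hγc : Tendsto γ (𝓝 0) (𝓝 x) := by
    have := (hγd 0).continuousAt.tendsto
    rwa [hγ0] at this
  have hd : ∀ᶠ t in 𝓝 (0 : ℝ), HasDerivAt (fun t => φ (γ t)) (fderiv ℝ φ (γ t) v) t := by
    filter_upwards [hγc.eventually hφ.eventually_hasFDerivAt] with t ht
    exact ht.comp_hasDerivAt t (hγd t)
  have hd1 : deriv (fun t => φ (γ t)) =ᶠ[𝓝 0] fun t => fderiv ℝ φ (γ t) v := by
    filter_upwards [hd] with t ht using ht.deriv
  have hd2 : HasDerivAt (fun t => fderiv ℝ φ (γ t) v) (hess φ x v v) 0 := by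
    have h1 : HasFDerivAt (fderiv ℝ φ) (hess φ x) (γ 0) := by
      rw [hγ0]; exact hφ.hasFDerivAt_hess
    have h2 := h1.comp_hasDerivAt (0 : ℝ) (hγd 0)
    simpa using h2.clm_apply (hasDerivAt_const (0 : ℝ) v)
  have hdd : deriv (deriv fun t => φ (γ t)) 0 = hess φ x v v := by
    rw [hd1.deriv_eq, hd2.deriv]
  have hmax' : IsLocalMax (fun t => φ (γ t)) 0 := by
    have := hγc.eventually hmax
    simpa [IsLocalMax, IsMaxFilter, hγ0] using this
  -- A positive second derivative would make the maximum along the line a minimum too, so the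
  -- function would be locally constant and its second derivative zero.
  have hmin : IsLocalMin (fun t => φ (γ t)) 0 :=
    isLocalMin_of_deriv_deriv_pos (by rw [hdd]; exact hpos) hmax'.deriv_eq_zero
      hd.self_of_nhds.continuousAt
  have hc : (fun t => φ (γ t)) =ᶠ[𝓝 0] fun _ => φ (γ 0) := by
    filter_upwards [hmin, hmax'] with t h1 h2 using le_antisymm h2 h1
  have hz : deriv (deriv fun t => φ (γ t)) 0 = 0 := by
    rw [hc.deriv.deriv_eq]
    simp
  rw [hdd] at hz
  exact hpos.ne' hz

end SecondDerivative

/-! ### The operator on compositions and on squared distances. -/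

section Composition

variable {ι E : Type*} [Fintype ι] [NormedAddCommGroup E] [InnerProductSpace ℝ E]

theorem ellOp_nonpos_of_isLocalMax (b : OrthonormalBasis ι ℝ E) (p : E) {φ : E → ℝ} {x : E}
    (hφ : ContDiffAt ℝ 2 φ x) (hmax : IsLocalMax φ x) : ellOp b p (hess φ x) ≤ 0 :=
  ellOp_nonpos b p (hess_nonpos_of_isLocalMax hφ hmax)

theorem ellOp_hess_comp (b : OrthonormalBasis ι ℝ E) (p : E) {φ : E → ℝ} {x d : E}
    (hφ : ContDiffAt ℝ 2 φ x) (hd : ∀ v, fderiv ℝ φ x v = inner ℝ d v)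
    {G G' : ℝ → ℝ} {G'' : ℝ}
    (hG : ∀ᶠ s in 𝓝 (φ x), HasDerivAt G (G' s) s) (hG' : HasDerivAt G' G'' (φ x)) :
    ellOp b p (hess (fun y => G (φ y)) x) = G' (φ x) * ellOp b p (hess φ x)
      + G'' * (‖d‖ ^ 2 - inner ℝ d p ^ 2 / (1 + ‖p‖ ^ 2)) := by
  rw [hess_comp hφ hG hG', ellOp_add, ellOp_smul, ellOp_smul]
  congr 2
  simp only [ellOp, ContinuousLinearMap.smulRight_apply, smul_apply, hd,
    smul_eq_mul]
  rw [← b.sum_inner_sq d]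
  congr 1
  · refine Finset.sum_congr rfl fun i _ => ?_
    rw [real_inner_comm, sq]
  · rw [sq (inner ℝ d p)]

theorem contDiff_norm_sub_sq (a : E) : ContDiff ℝ 2 fun y : E => ‖y - a‖ ^ 2 :=
  (contDiff_id.sub contDiff_const).norm_sq ℝ

theorem fderiv_norm_sub_sq (a x v : E) :
    fderiv ℝ (fun y : E => ‖y - a‖ ^ 2) x v = inner ℝ ((2 : ℝ) • (x - a)) v := by
  have h : HasFDerivAt (fun y : E => ‖y - a‖ ^ 2) _ x := ((hasFDerivAt_id x).sub_const a).norm_sq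
  rw [h.fderiv]
  simp [inner_smul_left, inner_sub_left]

theorem ellOp_hess_norm_sub_sq (b : OrthonormalBasis ι ℝ E) (p a x : E) :
    ellOp b p (hess (fun y : E => ‖y - a‖ ^ 2) x)
      = 2 * (Fintype.card ι - ‖p‖ ^ 2 / (1 + ‖p‖ ^ 2)) := by
  have h : ∀ v z, hess (fun y : E => ‖y - a‖ ^ 2) x v z = 2 * inner ℝ v z := by
    intro v z
    have h1 : fderiv ℝ (fun y : E => ‖y - a‖ ^ 2) = fun y => (2 : ℝ) • innerSL ℝ (y - a) := by
      ext y v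
      rw [fderiv_norm_sub_sq]
      simp [inner_smul_left, inner_sub_left]
    have h2 : HasFDerivAt (fun y => (2 : ℝ) • innerSL ℝ (y - a)) ((2 : ℝ) • innerSL ℝ (E := E)) x :=
      (((innerSL ℝ (E := E)).hasFDerivAt (x := x - a)).comp x
        ((hasFDerivAt_id x).sub_const a)).const_smul (2 : ℝ)
    rw [hess, h1, h2.fderiv]
    rfl
  simp only [ellOp, h, real_inner_self_eq_norm_sq, b.norm_eq_one]
  simp
  ring

end Composition

/-! ### Bernstein's inequality for the gradient. -/

section Bernstein

variable {ι E : Type*} [Fintype ι] [NormedAddCommGroup E] [InnerProductSpace ℝ E] [CompleteSpace E]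

theorem fderiv_eq_inner_gradient (u : E → ℝ) (x v : E) :
    fderiv ℝ u x v = inner ℝ (gradient u x) v := by
  simp [gradient]

theorem ContDiffAt.gradient {u : E → ℝ} {x : E} {m k : WithTop ℕ∞} (hu : ContDiffAt ℝ k u x)
    (hmk : m + 1 ≤ k) : ContDiffAt ℝ m (gradient u) x :=
  (toDual ℝ E).symm.contDiff.contDiffAt.comp x (hu.fderiv_right hmk)

theorem inner_fderiv_gradient {u : E → ℝ} {x : E} (hu : ContDiffAt ℝ 2 u x) (v z : E) :
    inner ℝ (fderiv ℝ (gradient u) x v) z = hess u x v z := by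
  have h : HasFDerivAt (gradient u) _ x :=
    ((toDual ℝ E).symm.toContinuousLinearEquiv.toContinuousLinearMap.hasFDerivAt
      (x := fderiv ℝ u x)).comp x hu.hasFDerivAt_hess
  rw [h.fderiv]
  simp

theorem inner_fderiv_gradient_symm {u : E → ℝ} {x : E} (hu : ContDiffAt ℝ 2 u x) (v z : E) :
    inner ℝ (fderiv ℝ (gradient u) x v) z = inner ℝ (fderiv ℝ (gradient u) x z) v := by
  rw [inner_fderiv_gradient hu, inner_fderiv_gradient hu, hess_symm hu]

theorem fderiv_norm_gradient_sq {u : E → ℝ} {x : E} (hu : ContDiffAt ℝ 2 u x) (v : E) :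
    fderiv ℝ (fun y => ‖gradient u y‖ ^ 2) x v
      = 2 * inner ℝ (gradient u x) (fderiv ℝ (gradient u) x v) := by
  have h := ((hu.gradient (m := 1) (by norm_num)).differentiableAt (by norm_num)).hasFDerivAt
  rw [h.norm_sq.fderiv]
  simp

theorem hess_norm_gradient_sq {u : E → ℝ} {x : E} (hu : ContDiffAt ℝ 3 u x) (v z : E) :
    hess (fun y => ‖gradient u y‖ ^ 2) x v z
      = 2 * (inner ℝ (gradient u x) (fderiv ℝ (fderiv ℝ (gradient u)) x v z)
        + inner ℝ (fderiv ℝ (gradient u) x v) (fderiv ℝ (gradient u) x z)) := by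
  have hX : ContDiffAt ℝ 2 (gradient u) x := hu.gradient (by norm_num)
  have hX1 := (hX.differentiableAt (by norm_num)).hasFDerivAt
  have hX2 := ((hX.fderiv_right (m := 1) (by norm_num)).differentiableAt (by norm_num)).hasFDerivAt
  have h1 : hess (fun y => ‖gradient u y‖ ^ 2) x v z
      = fderiv ℝ (fun y => fderiv ℝ (fun y => ‖gradient u y‖ ^ 2) y z) x v := by
    have := (hX.norm_sq ℝ).hasFDerivAt_hess.clm_apply (hasFDerivAt_const z x)
    rw [this.fderiv]
    simp
  have h2 : (fun y => fderiv ℝ (fun y => ‖gradient u y‖ ^ 2) y z)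
      =ᶠ[𝓝 x] fun y => 2 * inner ℝ (gradient u y) (fderiv ℝ (gradient u) y z) := by
    filter_upwards [(hu.of_le (by norm_num : (2 : WithTop ℕ∞) ≤ 3)).eventually (by simp)] with y hy
    exact fderiv_norm_gradient_sq hy z
  have h3 := (hX1.inner ℝ (hX2.clm_apply (hasFDerivAt_const z x))).const_mul 2
  rw [h1, h2.fderiv_eq, h3.fderiv]
  simp [add_comm]

/-- The Frobenius bound involves the trace corrected by `s/w`, the equation the trace corrected by
`s/(1+w)`; they differ by `t`. Since `g² ≤ 2(g-t)² + 2t²`, it suffices that `t² ≤ a/w - a/(1+w)`,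
which is the surplus left by the term `a/w`. -/
theorem bernstein_real_inequality {w n a s g N trH : ℝ} (hw : 0 < w) (hn : 1 ≤ n)
    (hs : s ^ 2 ≤ a * w) (hN : a / w + (trH - s / w) ^ 2 / n ≤ N) (hg : trH - s / (1 + w) = g) :
    g ^ 2 / n ≤ 2 * N - 2 * a / (1 + w) := by
  have hn0 : 0 < n := by linarith
  set t := s / (w * (1 + w)) with ht
  have h1 : trH - s / w = g - t := by
    rw [← hg, ht]; field_simp; ring
  rw [h1] at hN
  have h2 : g ^ 2 / n ≤ 2 * ((g - t) ^ 2 / n) + 2 * t ^ 2 := by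
    have h3 : g ^ 2 / n ≤ (2 * (g - t) ^ 2 + 2 * t ^ 2) / n := by
      gcongr
      nlinarith [sq_nonneg (g - 2 * t)]
    have h4 : 2 * t ^ 2 / n ≤ 2 * t ^ 2 := div_le_self (by positivity) hn
    rw [add_div, mul_div_assoc] at h3
    linarith
  have h5 : t ^ 2 ≤ a / w - a / (1 + w) := by
    have e : a / w - a / (1 + w) = a / (w * (1 + w)) := by field_simp; ring
    rw [e, ht, div_pow, div_le_div_iff₀ (by positivity) (by positivity)]
    have ha : 0 ≤ a := by
      by_contra! hneg
      nlinarith [sq_nonneg s]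
    have : s ^ 2 * (w * (1 + w)) ≤ (a * w) * (w * (1 + w)) := by gcongr
    have h6 : (a * w) * (w * (1 + w)) ≤ a * (w * (1 + w)) ^ 2 := by
      have : 0 ≤ a * w ^ 3 * (1 + w) := by positivity
      nlinarith
    linarith
  have h7 : 2 * a / (1 + w) = 2 * (a / (1 + w)) := by ring
  rw [h7]
  linarith

/-- The equation `ellOp (∇u) (D²u) = g (|∇u|²)`, differentiated in the direction `∇u`. -/
theorem differentiated_equation (b : OrthonormalBasis ι ℝ E) {u : E → ℝ} {x : E}
    (hu : ContDiffAt ℝ 3 u x) {g : ℝ → ℝ} {g' : ℝ} (hg : HasDerivAt g g' (‖gradient u x‖ ^ 2))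
    (heq : ∀ᶠ y in 𝓝 x, ellOp b (gradient u y) (hess u y) = g (‖gradient u y‖ ^ 2)) :
    let p := gradient u x
    let h := fderiv ℝ (gradient u) x p
    let T := fderiv ℝ (fderiv ℝ (gradient u)) x p
    ∑ i, inner ℝ (T (b i)) (b i) - ((inner ℝ (T p) p + 2 * ‖h‖ ^ 2) * (1 + ‖p‖ ^ 2)
      - 2 * inner ℝ h p ^ 2) / (1 + ‖p‖ ^ 2) ^ 2 = g' * (2 * inner ℝ h p) := by
  intro p h T
  have hu2 : ContDiffAt ℝ 2 u x := hu.of_le (by norm_num)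
  have hX : ContDiffAt ℝ 2 (gradient u) x := hu.gradient (by norm_num)
  have hX1 := (hX.differentiableAt (by norm_num)).hasFDerivAt
  have hX2 := ((hX.fderiv_right (m := 1) (by norm_num)).differentiableAt (by norm_num)).hasFDerivAt
  -- Only the derivative in the fixed direction `p` is needed, so the equation is differentiated
  -- along a line.
  set γ : ℝ → E := fun t => x + t • p with hγ
  have hγ0 : γ 0 = x := by simp [hγ]
  have hγd : HasDerivAt γ p 0 := by
    simpa [hγ] using ((hasDerivAt_id (0 : ℝ)).smul_const p).const_add x
  rw [← hγ0] at hX1 hX2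
  have dX : HasDerivAt (fun t => gradient u (γ t)) h 0 := by
    have := hX1.comp_hasDerivAt (0 : ℝ) hγd
    rwa [hγ0] at this
  have dH : HasDerivAt (fun t => fderiv ℝ (gradient u) (γ t)) T 0 := by
    have := hX2.comp_hasDerivAt (0 : ℝ) hγd
    rwa [hγ0] at this
  have dtr : HasDerivAt (fun t => ∑ i, inner ℝ (fderiv ℝ (gradient u) (γ t) (b i)) (b i))
      (∑ i, inner ℝ (T (b i)) (b i)) 0 := by
    refine HasDerivAt.fun_sum fun i _ => ?_
    simpa using (dH.clm_apply (hasDerivAt_const (0 : ℝ) (b i))).inner ℝ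
      (hasDerivAt_const (0 : ℝ) (b i))
  have dnum := (dH.clm_apply dX).inner ℝ dX
  have dw := dX.norm_sq
  have dden := dw.const_add 1
  have hgc : HasDerivAt g g' (‖gradient u (γ 0)‖ ^ 2) := by rw [hγ0]; exact hg
  have dg := hgc.comp (0 : ℝ) dw
  have dall := (dtr.sub (dnum.div dden (by positivity))).sub dg
  have hγc : Tendsto γ (𝓝 0) (𝓝 x) := by
    have := hγd.continuousAt.tendsto
    rwa [hγ0] at this
  have hzero := dall.congr_of_eventuallyEq (f₁ := fun _ => (0 : ℝ)) (by
    filter_upwards [hγc.eventually heq, hγc.eventually (hu2.eventually (by simp))] with t h1 h2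
    simp only [Pi.sub_apply, Pi.div_apply, Function.comp_apply, ← h1, ellOp,
      inner_fderiv_gradient h2]
    ring)
  have hfin := hzero.unique (hasDerivAt_const (0 : ℝ) (0 : ℝ))
  simp only [hγ0] at hfin
  have e1 : inner ℝ (fderiv ℝ (gradient u) x h) p = ‖h‖ ^ 2 := by
    rw [inner_fderiv_gradient_symm hu2, real_inner_self_eq_norm_sq]
  have e2 : inner ℝ (fderiv ℝ (gradient u) x (gradient u x)) h = ‖h‖ ^ 2 :=
    real_inner_self_eq_norm_sq h
  change _ - ((inner ℝ (fderiv ℝ (gradient u) x p) h +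
    inner ℝ (T p + fderiv ℝ (gradient u) x h) p) * (1 + ‖p‖ ^ 2)
    - inner ℝ h p * (2 * inner ℝ p h)) / (1 + ‖p‖ ^ 2) ^ 2 - g' * (2 * inner ℝ p h) = 0 at hfin
  rw [inner_add_left, e1, e2, real_inner_comm h p] at hfin
  rw [← sub_eq_zero, ← hfin]
  ring

/-- Bernstein's inequality for `log (1 + |∇u|²)`. -/
theorem bernstein_inequality (b : OrthonormalBasis ι ℝ E) {u : E → ℝ} {x : E}
    (hu : ContDiffAt ℝ 3 u x) (hx : gradient u x ≠ 0) {g : ℝ → ℝ} {g' : ℝ}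
    (hg : HasDerivAt g g' (‖gradient u x‖ ^ 2))
    (heq : ∀ᶠ y in 𝓝 x, ellOp b (gradient u y) (hess u y) = g (‖gradient u y‖ ^ 2)) :
    g (‖gradient u x‖ ^ 2) ^ 2 / (Fintype.card ι * (1 + ‖gradient u x‖ ^ 2)) +
      2 * g' * fderiv ℝ (fun y => Real.log (1 + ‖gradient u y‖ ^ 2)) x (gradient u x)
    ≤ ellOp b (gradient u x) (hess (fun y => Real.log (1 + ‖gradient u y‖ ^ 2)) x) := by
  have hde := differentiated_equation b hu hg heq
  have hE := heq.self_of_nhds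
  have hu2 : ContDiffAt ℝ 2 u x := hu.of_le (by norm_num)
  have hX : ContDiffAt ℝ 2 (gradient u) x := hu.gradient (by norm_num)
  have hX2 := ((hX.fderiv_right (m := 1) (by norm_num)).differentiableAt (by norm_num)).hasFDerivAt
  set p := gradient u x with hp
  set H := fderiv ℝ (gradient u) x with hH
  set T := fderiv ℝ (fderiv ℝ (gradient u)) x with hT
  have hw : 0 < ‖p‖ ^ 2 := by positivity
  have : Nonempty ι := by
    by_contra hemp
    rw [not_nonempty_iff] at hemp
    apply hx
    have := b.sum_repr p
    simpa using this.symm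
  have hn : (1 : ℝ) ≤ Fintype.card ι := by exact_mod_cast Fintype.card_pos
  have hwC : ContDiffAt ℝ 2 (fun y => ‖gradient u y‖ ^ 2) x := hX.norm_sq ℝ
  have hdw : ∀ v, fderiv ℝ (fun y => ‖gradient u y‖ ^ 2) x v = inner ℝ ((2 : ℝ) • H p) v := by
    intro v
    rw [fderiv_norm_gradient_sq hu2, real_inner_smul_left, real_inner_comm,
      inner_fderiv_gradient_symm hu2]
  have hlog : ∀ᶠ s in 𝓝 (‖p‖ ^ 2), HasDerivAt (fun s : ℝ => Real.log (1 + s)) ((1 + s)⁻¹) s := by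
    filter_upwards [lt_mem_nhds hw] with s hs
    simpa using ((hasDerivAt_id s).const_add 1).log (by simp; positivity)
  have hlog' : HasDerivAt (fun s : ℝ => (1 + s)⁻¹) (-1 / (1 + ‖p‖ ^ 2) ^ 2) (‖p‖ ^ 2) := by
    simpa using ((hasDerivAt_id (‖p‖ ^ 2)).const_add 1).fun_inv (by simp; positivity)
  have hdl : fderiv ℝ (fun y => Real.log (1 + ‖gradient u y‖ ^ 2)) x p
      = 2 * inner ℝ (H p) p / (1 + ‖p‖ ^ 2) := by
    have := (hlog.self_of_nhds).comp_hasFDerivAt x hwC.eventually_hasFDerivAt.self_of_nhds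
    have h2 : fderiv ℝ (fun y => Real.log (1 + ‖gradient u y‖ ^ 2)) x = _ := this.fderiv
    rw [h2, smul_apply, hdw, real_inner_smul_left, smul_eq_mul]
    ring
  have Tsymm1 : ∀ v z, T v z = T z v := (hX.isSymmSndFDerivAt (by simp))
  have Tsymm2 : ∀ v z y, inner ℝ (T v z) y = inner ℝ (T v y) z := by
    intro v z y
    have d : ∀ z y, HasFDerivAt (fun a => inner ℝ (fderiv ℝ (gradient u) a z) y) _ x :=
      fun z y => (hX2.clm_apply (hasFDerivAt_const z x)).inner ℝ (hasFDerivAt_const y x)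
    have e : (fun a => inner ℝ (fderiv ℝ (gradient u) a z) y)
        =ᶠ[𝓝 x] (fun a => inner ℝ (fderiv ℝ (gradient u) a y) z) := by
      filter_upwards [hu2.eventually (by simp)] with a ha
      exact inner_fderiv_gradient_symm ha z y
    have := congrArg (fun D => D v) ((d z y).fderiv.symm.trans (e.fderiv_eq.trans (d y z).fderiv))
    simpa using this
  -- Full symmetry of the third derivative moves `p` into the differentiation slot; the
  -- differentiated equation then eliminates all third-order terms.
  have Tsymm : ∀ v, inner ℝ p (T v v) = inner ℝ (T p v) v := by
    intro v
    rw [real_inner_comm, Tsymm2, Tsymm1]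
  have hLw : ellOp b p (hess (fun y => ‖gradient u y‖ ^ 2) x)
      = 2 * ∑ i, ‖H (b i)‖ ^ 2 + 2 * ∑ i, inner ℝ (T p (b i)) (b i)
        - 2 * (inner ℝ (T p p) p + ‖H p‖ ^ 2) / (1 + ‖p‖ ^ 2) := by
    simp only [ellOp, hess_norm_gradient_sq hu, ← hp, ← hT, ← hH, Tsymm, real_inner_self_eq_norm_sq,
      ← Finset.mul_sum, Finset.sum_add_distrib]
    ring
  rw [ellOp_hess_comp b p hwC hdw hlog hlog', hLw, hdl, norm_smul, real_inner_smul_left]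
  have hfrob := sum_norm_sq_apply_ge b hx H
  have hs : inner ℝ (H p) p ^ 2 ≤ ‖H p‖ ^ 2 * ‖p‖ ^ 2 := by
    rw [← mul_pow, ← sq_abs (inner ℝ (H p) p)]
    exact pow_le_pow_left₀ (abs_nonneg _) (abs_real_inner_le_norm _ _) 2
  have hE' : ∑ i, inner ℝ (H (b i)) (b i) - inner ℝ (H p) p / (1 + ‖p‖ ^ 2) = g (‖p‖ ^ 2) := by
    rw [← hE, ellOp]
    simp only [hH, inner_fderiv_gradient hu2]
  have key := bernstein_real_inequality hw hn hs hfrob hE'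
  simp only [Real.norm_ofNat] at *
  generalize ∑ i, inner ℝ (T p (b i)) (b i) = τ at *
  generalize ∑ i, ‖H (b i)‖ ^ 2 = N at *
  generalize inner ℝ (T p p) p = σ at *
  generalize inner ℝ (H p) p = s at *
  generalize g (‖p‖ ^ 2) = G at *
  generalize ‖H p‖ = a at *
  generalize ‖p‖ ^ 2 = w at *
  have hτ : τ = g' * (2 * s) + ((σ + 2 * a ^ 2) * (1 + w) - 2 * s ^ 2) / (1 + w) ^ 2 := by
    linarith
  have hw1 : 0 < 1 + w := by linarith
  -- With the logarithm the `s²` terms and the third-order `σ` terms cancel exactly, leaving the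
  -- combination bounded by `key`.
  have hfin : (1 + w)⁻¹ * (2 * N + 2 * τ - 2 * (σ + a ^ 2) / (1 + w))
      + -1 / (1 + w) ^ 2 * ((2 * a) ^ 2 - (2 * s) ^ 2 / (1 + w))
      = (1 + w)⁻¹ * (2 * N - 2 * a ^ 2 / (1 + w)) + 2 * g' * (2 * s / (1 + w)) := by
    rw [hτ]
    field_simp
    ring
  rw [hfin]
  have : G ^ 2 / (Fintype.card ι * (1 + w)) = (1 + w)⁻¹ * (G ^ 2 / Fintype.card ι) := by
    field_simp
  rw [this]
  gcongr

end Bernstein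

/-! ### Passage from the divergence equation to the logarithmic gradient. -/

section Equation

variable {n : ℕ} {u : EuclideanSpace ℝ (Fin n) → ℝ}

/-- The mean curvature operator in nondivergence form. -/
theorem sqrt_mul_meanCurvatureOp {x : EuclideanSpace ℝ (Fin n)} (hu : ContDiffAt ℝ 2 u x) :
    Real.sqrt (1 + ‖gradient u x‖ ^ 2) * meanCurvatureOp u x
      = ellOp (EuclideanSpace.basisFun (Fin n) ℝ) (gradient u x) (hess u x) := by
  set b := EuclideanSpace.basisFun (Fin n) ℝ with hb
  have hX : ContDiffAt ℝ 1 (gradient u) x := hu.gradient (by norm_num)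
  have hX1 := (hX.differentiableAt (by norm_num)).hasFDerivAt
  have hw1 := ((hX.norm_sq ℝ).differentiableAt (by norm_num)).hasFDerivAt
  set p := gradient u x with hp
  have hpos : 0 < 1 + ‖p‖ ^ 2 := by positivity
  set s := Real.sqrt (1 + ‖p‖ ^ 2) with hs
  have hs0 : 0 < s := Real.sqrt_pos.2 hpos
  have hs2 : s ^ 2 = 1 + ‖p‖ ^ 2 := Real.sq_sqrt hpos.le
  have hr : HasDerivAt (fun r : ℝ => (Real.sqrt (1 + r))⁻¹) (-(1 / (2 * s)) / s ^ 2) (‖p‖ ^ 2) :=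
    (((hasDerivAt_id (‖p‖ ^ 2)).const_add 1).sqrt hpos.ne').fun_inv hs0.ne'
  have hρ := hr.comp_hasFDerivAt x hw1
  have hV := hρ.smul hX1
  have e : ∀ i, (fderiv ℝ (fun y => (Real.sqrt (1 + ‖gradient u y‖ ^ 2))⁻¹ • gradient u y) x
      (EuclideanSpace.single i 1)) i = s⁻¹ * hess u x (b i) (b i)
      + -(1 / (2 * s)) / s ^ 2 *
        (inner ℝ (b i) p * fderiv ℝ (fun y => ‖gradient u y‖ ^ 2) x (b i)) := by
    intro i
    have h1 : fderiv ℝ (fun y => (Real.sqrt (1 + ‖gradient u y‖ ^ 2))⁻¹ • gradient u y) x = _ :=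
      hV.fderiv
    have h2 : ∀ v : EuclideanSpace ℝ (Fin n), v i = inner ℝ v (b i) := by
      intro v
      simp [hb, EuclideanSpace.inner_single_right]
    rw [h2, h1, ← EuclideanSpace.basisFun_apply (Fin n) ℝ i, ← hb]
    simp only [add_apply, smul_apply, ContinuousLinearMap.smulRight_apply, inner_add_left,
      real_inner_smul_left, inner_fderiv_gradient hu, Function.comp_apply, smul_eq_mul, ← hp, ← hs]
    rw [real_inner_comm p (b i)]
    ring
  rw [meanCurvatureOp, euclideanDiv]
  simp only [e, Finset.sum_add_distrib, ← Finset.mul_sum, b.sum_inner_mul_apply]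
  rw [fderiv_norm_gradient_sq hu, real_inner_comm, inner_fderiv_gradient hu, ellOp, ← hs2]
  field_simp
  ring

theorem IsEntireSolution.continuous_gradient {f : EuclideanSpace ℝ (Fin n) → ℝ}
    (h : IsEntireSolution f u) : Continuous (gradient u) :=
  (toDual ℝ _).symm.continuous.comp (h.contDiff_one.continuous_fderiv (by norm_num))

theorem IsEntireSolution.eventually_gradient_ne_zero {f : EuclideanSpace ℝ (Fin n) → ℝ}
    (h : IsEntireSolution f u) {x : EuclideanSpace ℝ (Fin n)} (hx : gradient u x ≠ 0) :
    ∀ᶠ y in 𝓝 x, gradient u y ≠ 0 :=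
  h.continuous_gradient.continuousAt.eventually_ne hx

theorem IsEntireSolution.contDiffAt {f : EuclideanSpace ℝ (Fin n) → ℝ}
    (h : IsEntireSolution f u) {x : EuclideanSpace ℝ (Fin n)} (hx : gradient u x ≠ 0) :
    ContDiffAt ℝ 3 u x :=
  h.contDiffOn_three.contDiffAt (h.eventually_gradient_ne_zero hx)

theorem IsEntireSolution.ellOp_hess_eq {f : EuclideanSpace ℝ (Fin n) → ℝ}
    (h : IsEntireSolution f u) {x : EuclideanSpace ℝ (Fin n)} (hx : gradient u x ≠ 0) :
    ellOp (EuclideanSpace.basisFun (Fin n) ℝ) (gradient u x) (hess u x)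
      = Real.sqrt (1 + ‖gradient u x‖ ^ 2) * f (gradient u x) := by
  rw [← sqrt_mul_meanCurvatureOp ((h.contDiffAt hx).of_le (by norm_num)), h.equation x hx]

/-- The logarithmic gradient `log (1 + |∇u|²)`. -/
noncomputable def logGrad (u : EuclideanSpace ℝ (Fin n) → ℝ) (x : EuclideanSpace ℝ (Fin n)) : ℝ :=
  Real.log (1 + ‖gradient u x‖ ^ 2)

theorem exp_logGrad (x : EuclideanSpace ℝ (Fin n)) :
    Real.exp (logGrad u x) = 1 + ‖gradient u x‖ ^ 2 :=
  Real.exp_log (by positivity)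

theorem logGrad_pos {x : EuclideanSpace ℝ (Fin n)} (hx : gradient u x ≠ 0) : 0 < logGrad u x :=
  Real.log_pos (by have : 0 < ‖gradient u x‖ ^ 2 := by positivity
                   linarith)

theorem gradient_ne_zero_of_logGrad_pos {x : EuclideanSpace ℝ (Fin n)} (hx : 0 < logGrad u x) :
    gradient u x ≠ 0 := by
  intro h
  simp [logGrad, h] at hx

theorem IsEntireSolution.continuous_logGrad {f : EuclideanSpace ℝ (Fin n) → ℝ}
    (h : IsEntireSolution f u) : Continuous (logGrad u) :=
  (continuous_const.add (h.continuous_gradient.norm.pow 2)).log fun x =>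
    (by positivity : 0 < 1 + ‖gradient u x‖ ^ 2).ne'

theorem IsEntireSolution.contDiffAt_logGrad {f : EuclideanSpace ℝ (Fin n) → ℝ}
    (h : IsEntireSolution f u) {x : EuclideanSpace ℝ (Fin n)} (hx : gradient u x ≠ 0) :
    ContDiffAt ℝ 2 (logGrad u) x :=
  (contDiffAt_const.add (((h.contDiffAt hx).gradient (by norm_num)).norm_sq ℝ)).log (by positivity)

/-- This is `bernstein_inequality` with `g(w) = √(1+w) F(log(1+w))`: the factor `1+w` in the
denominator cancels, and `2g'` becomes `(F + 2F')/√(1+w)`. -/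
theorem IsEntireSolution.bernstein {F : ℝ → ℝ} {F' : ℝ}
    (h : IsEntireSolution (fun p => F (Real.log (1 + ‖p‖ ^ 2))) u)
    {x : EuclideanSpace ℝ (Fin n)} (hx : gradient u x ≠ 0) (hF : HasDerivAt F F' (logGrad u x)) :
    F (logGrad u x) ^ 2 / n + (F (logGrad u x) + 2 * F')
        * (fderiv ℝ (logGrad u) x (gradient u x) / Real.sqrt (1 + ‖gradient u x‖ ^ 2))
      ≤ ellOp (EuclideanSpace.basisFun (Fin n) ℝ) (gradient u x) (hess (logGrad u) x) := by
  set w := ‖gradient u x‖ ^ 2 with hw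
  have hw0 : 0 ≤ w := by positivity
  have hpos : 0 < 1 + w := by positivity
  set s := Real.sqrt (1 + w) with hs
  have hs0 : 0 < s := Real.sqrt_pos.2 hpos
  have hs2 : s ^ 2 = 1 + w := Real.sq_sqrt hpos.le
  have h1 : HasDerivAt (fun r : ℝ => 1 + r) 1 w := by simpa using (hasDerivAt_id w).const_add 1
  have hF' : HasDerivAt F F' (Real.log (1 + w)) := hF
  have hg := (h1.sqrt hpos.ne').mul (hF'.comp w (h1.log hpos.ne'))
  have key := bernstein_inequality (EuclideanSpace.basisFun (Fin n) ℝ) (h.contDiffAt hx) hx hg (by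
    filter_upwards [h.eventually_gradient_ne_zero hx] with y hy
    exact h.ellOp_hess_eq hy)
  refine le_trans (le_of_eq ?_) key
  change F (logGrad u x) ^ 2 / n + (F (logGrad u x) + 2 * F') *
    (fderiv ℝ (logGrad u) x (gradient u x) / s) = (s * F (logGrad u x)) ^ 2 /
    (Fintype.card (Fin n) * (1 + w)) + 2 * (1 / (2 * s) * F (logGrad u x) + s * (F' * (1 / (1 + w))))
      * fderiv ℝ (logGrad u) x (gradient u x)
  rw [Fintype.card_fin, ← hs2]
  have hn : (n : ℝ) ≠ 0 := by
    rintro h0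
    have : n = 0 := by exact_mod_cast h0
    subst this
    exact hx (Subsingleton.elim _ _)
  field_simp

theorem exists_eq_const_of_gradient_eq_zero (hu : Differentiable ℝ u)
    (h : ∀ x, gradient u x = 0) : ∃ c : ℝ, ∀ x, u x = c := by
  refine ⟨u 0, fun x => is_const_of_fderiv_eq_zero hu (fun y => ?_) x 0⟩
  ext v
  rw [fderiv_eq_inner_gradient, h y]
  simp

end Equation

/-! ### Superlinear growth in the logarithmic gradient. -/

section Superlinear

variable {n : ℕ} {u : EuclideanSpace ℝ (Fin n) → ℝ}

theorem abs_inner_div_sqrt_le {E : Type*} [NormedAddCommGroup E] [InnerProductSpace ℝ E] (d p : E) :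
    |inner ℝ d p / Real.sqrt (1 + ‖p‖ ^ 2)| ≤ ‖d‖ := by
  have hs : ‖p‖ ≤ Real.sqrt (1 + ‖p‖ ^ 2) := Real.le_sqrt_of_sq_le (by linarith)
  have hs0 : 0 < Real.sqrt (1 + ‖p‖ ^ 2) := Real.sqrt_pos.2 (by positivity)
  rw [abs_div, abs_of_pos hs0, div_le_iff₀ hs0]
  exact (abs_real_inner_le_norm d p).trans (by gcongr)

theorem card_sub_div_le (n : ℕ) (w : ℝ) (hw : 0 ≤ w) : (n : ℝ) - w / (1 + w) ≤ n := by
  have : 0 ≤ w / (1 + w) := by positivity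
  linarith

/-- Since `Y` and `|F'|` are controlled by `F`, each error is a constant times `F²/R`. Dividing by
`F²` bounds `R`. Here `Y` stands for `l^κ` and `D` for the normalised derivative of `l` along `∇u`.
-/
theorem superlinear_real_inequality {n κ l Y F F' C D Λ δ Y₀ k R : ℝ} (hn : 0 < n) (hκ : 0 < κ)
    (hδ : 0 < δ) (hl : δ ≤ l) (hY₀ : 0 < Y₀) (hY : Y₀ ≤ Y) (hYF : Y ≤ C * F) (hF' : |F'| ≤ C * F)
    (hC : 0 < C) (hk : 0 < k) (hR : 1 ≤ R) (hD : |D| ≤ k * Y / R)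
    (hlow : F ^ 2 / n + (F + 2 * F') * D ≤ Λ)
    (hup : Λ ≤ κ * (k * Y / R) ^ 2 / l + k * n * Y / R ^ 2) :
    R ≤ n * ((1 + 2 * C) * (k * C) + κ * (k * C) ^ 2 / δ + k * n * C ^ 2 / Y₀) := by
  have hR0 : 0 < R := by linarith
  have hYpos : 0 < Y := by linarith
  have hFpos : 0 < F := by
    by_contra! hneg
    nlinarith
  have h1 : |(F + 2 * F') * D| ≤ (1 + 2 * C) * (k * C) / R * F ^ 2 := by
    rw [abs_mul]
    have e1 : |F + 2 * F'| ≤ (1 + 2 * C) * F := by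
      refine (abs_add_le _ _).trans ?_
      rw [abs_mul, abs_of_pos hFpos, abs_two]
      linarith
    have e2 : |D| ≤ k * (C * F) / R := hD.trans (by gcongr)
    calc |F + 2 * F'| * |D| ≤ ((1 + 2 * C) * F) * (k * (C * F) / R) := by gcongr
      _ = _ := by ring
  have h2 : κ * (k * Y / R) ^ 2 / l ≤ κ * (k * C) ^ 2 / δ / R * F ^ 2 := by
    calc κ * (k * Y / R) ^ 2 / l ≤ κ * (k * (C * F) / R) ^ 2 / δ := by gcongr
      _ = κ * (k * C) ^ 2 / δ * F ^ 2 / R ^ 2 := by ring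
      _ ≤ κ * (k * C) ^ 2 / δ * F ^ 2 / R := by
        gcongr
        nlinarith
      _ = _ := by ring
  have h3 : k * n * Y / R ^ 2 ≤ k * n * C ^ 2 / Y₀ / R * F ^ 2 := by
    have e : Y ≤ (C * F) ^ 2 / Y₀ := by
      rw [le_div_iff₀ hY₀]
      nlinarith
    calc k * n * Y / R ^ 2 ≤ k * n * ((C * F) ^ 2 / Y₀) / R := by
          gcongr
          nlinarith
      _ = _ := by ring
  have h4 : F ^ 2 / n ≤ ((1 + 2 * C) * (k * C) + κ * (k * C) ^ 2 / δ + k * n * C ^ 2 / Y₀) / R * F ^ 2 := by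
    have := neg_abs_le ((F + 2 * F') * D)
    have e : ((1 + 2 * C) * (k * C) + κ * (k * C) ^ 2 / δ + k * n * C ^ 2 / Y₀) / R * F ^ 2
      = (1 + 2 * C) * (k * C) / R * F ^ 2 + κ * (k * C) ^ 2 / δ / R * F ^ 2
        + k * n * C ^ 2 / Y₀ / R * F ^ 2 := by ring
    rw [e]
    linarith
  have h5 : 1 / n ≤ ((1 + 2 * C) * (k * C) + κ * (k * C) ^ 2 / δ + k * n * C ^ 2 / Y₀) / R := by
    refine le_of_mul_le_mul_right ?_ (by positivity : 0 < F ^ 2)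
    calc 1 / n * F ^ 2 = F ^ 2 / n := by ring
      _ ≤ _ := h4
  rw [div_le_div_iff₀ hn hR0] at h5
  linarith

/-- Liouville theorem when the right-hand side grows superlinearly in `log (1 + |∇u|²)`. -/
theorem IsEntireSolution.gradient_eq_zero_of_superlinear {F F' : ℝ → ℝ}
    (hF : ∀ l, 0 < l → HasDerivAt F (F' l) l) {κ : ℝ} (hκ : 1 < κ)
    (hgrowth : ∀ δ, 0 < δ → ∃ C, 0 < C ∧ ∀ l, δ ≤ l → l ^ κ ≤ C * F l ∧ |F' l| ≤ C * F l)
    (h : IsEntireSolution (fun p => F (Real.log (1 + ‖p‖ ^ 2))) u)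
    (x₀ : EuclideanSpace ℝ (Fin n)) : gradient u x₀ = 0 := by
  by_contra hx₀
  have hn : (0 : ℝ) < n := by
    rcases Nat.eq_zero_or_pos n with h0 | h0
    · subst h0
      exact absurd (Subsingleton.elim _ _) hx₀
    · exact_mod_cast h0
  have hl₀ := logGrad_pos hx₀
  set δ := logGrad u x₀ / 2 with hδdef
  have hδ : 0 < δ := by positivity
  obtain ⟨C, hC, hCF⟩ := hgrowth δ hδ
  set K := δ ^ (1 - κ) with hK
  have hK0 : 0 < K := Real.rpow_pos_of_pos hδ _
  have hκ1 : 0 < κ - 1 := by linarith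
  set k := 2 * K / (κ - 1) with hk
  have hk0 : 0 < k := by positivity
  set M := n * ((1 + 2 * C) * (k * C) + κ * (k * C) ^ 2 / δ + k * n * C ^ 2 / δ ^ κ) with hM
  set R := max 1 (M + 1) with hR
  have hR1 : 1 ≤ R := le_max_left _ _
  have hR0 : 0 < R := by linarith
  -- `K` is chosen so that `P ≤ -K` both where `l = δ` and on the sphere of radius `R`, while `P x₀
  -- > -K` because `l(x₀) = 2δ`. Hence the maximum is interior.
  set P : EuclideanSpace ℝ (Fin n) → ℝ :=
    fun y => -(logGrad u y) ^ (1 - κ) + -(K / R ^ 2) * ‖y - x₀‖ ^ 2 with hP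
  have hcl := h.continuous_logGrad
  obtain ⟨x, ⟨hxball, hxl⟩, hmax⟩ : ∃ x ∈ Metric.closedBall x₀ R ∩ {y | δ ≤ logGrad u y},
      IsMaxOn P (Metric.closedBall x₀ R ∩ {y | δ ≤ logGrad u y}) x := by
    refine ((isCompact_closedBall x₀ R).inter_right (isClosed_le continuous_const hcl)).exists_isMaxOn
      ⟨x₀, by simp [hR0.le], by show δ ≤ logGrad u x₀; linarith⟩ ?_
    refine ContinuousOn.add (ContinuousOn.neg ?_) (by fun_prop)
    refine hcl.continuousOn.rpow_const fun y hy => Or.inl ?_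
    exact (hδ.trans_le hy.2).ne'
  have hxl : δ ≤ logGrad u x := hxl
  have hl0 : 0 < logGrad u x := hδ.trans_le hxl
  have hPx : -K < P x := by
    refine lt_of_lt_of_le ?_ (hmax (a := x₀) ⟨by simp [hR0.le], by
      show δ ≤ logGrad u x₀; linarith⟩)
    have : logGrad u x₀ ^ (1 - κ) < K :=
      Real.rpow_lt_rpow_of_neg hδ (by linarith) (by linarith)
    simpa [hP] using this
  have hxδ : δ < logGrad u x := by
    refine lt_of_le_of_ne hxl fun heq => ?_
    have : 0 ≤ K / R ^ 2 * ‖x - x₀‖ ^ 2 := by positivity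
    simp only [hP, ← heq] at hPx
    rw [← hK] at hPx
    linarith
  have hxR : ‖x - x₀‖ < R := by
    by_contra! hge
    have h1 : 0 < logGrad u x ^ (1 - κ) := Real.rpow_pos_of_pos hl0 _
    have h2 : K ≤ K / R ^ 2 * ‖x - x₀‖ ^ 2 := by
      calc K = K / R ^ 2 * R ^ 2 := by field_simp
        _ ≤ _ := by gcongr
    simp only [hP] at hPx
    linarith
  have hloc : IsLocalMax P x := by
    refine hmax.isLocalMax ?_
    filter_upwards [Metric.isOpen_ball.mem_nhds (show x ∈ Metric.ball x₀ R by
      simpa [dist_eq_norm] using hxR), hcl.continuousAt.eventually (lt_mem_nhds hxδ)] with y h1 h2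
    exact ⟨Metric.ball_subset_closedBall h1, h2.le⟩
  have hx : gradient u x ≠ 0 := gradient_ne_zero_of_logGrad_pos hl0
  have hCl := h.contDiffAt_logGrad hx
  set b := EuclideanSpace.basisFun (Fin n) ℝ with hb
  set p := gradient u x with hp
  set l := logGrad u x with hl
  have hG : ∀ᶠ s in 𝓝 l, HasDerivAt (fun s : ℝ => -s ^ (1 - κ)) ((κ - 1) * s ^ (-κ)) s := by
    filter_upwards [lt_mem_nhds hl0] with s hs
    have := (Real.hasDerivAt_rpow_const (x := s) (p := 1 - κ) (Or.inl hs.ne')).fun_neg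
    refine this.congr_deriv ?_
    rw [show (1 - κ - 1) = -κ by ring]
    ring
  have hG' : HasDerivAt (fun s : ℝ => (κ - 1) * s ^ (-κ)) (-(κ * (κ - 1)) * l ^ (-κ - 1)) l := by
    have := (Real.hasDerivAt_rpow_const (x := l) (p := -κ) (Or.inl hl0.ne')).const_mul (κ - 1)
    refine this.congr_deriv ?_
    ring
  have hGC : ContDiffAt ℝ 2 (fun y => -(logGrad u y) ^ (1 - κ)) x :=
    (hCl.rpow_const_of_ne hl0.ne').neg
  have hNC : ContDiffAt ℝ 2 (fun y => ‖y - x₀‖ ^ 2) x := (contDiff_norm_sub_sq x₀).contDiffAt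
  have hPC : ContDiffAt ℝ 2 P x := hGC.add (contDiffAt_const.mul hNC)
  have hlpow : 0 < l ^ κ := Real.rpow_pos_of_pos hl0 _
  have hneg : l ^ (-κ) = (l ^ κ)⁻¹ := Real.rpow_neg hl0.le κ
  -- The value of `∇l` forced by the critical point equation for `P`; its length is at most `k
  -- l^κ/R`, which the growth hypothesis compares with `F`.
  set d := (2 * (K / R ^ 2) / (κ - 1) * l ^ κ) • (x - x₀) with hd
  have hdl : ∀ v, fderiv ℝ (logGrad u) x v = inner ℝ d v := by
    intro v
    have h1 := hG.self_of_nhds.comp_hasFDerivAt x hCl.eventually_hasFDerivAt.self_of_nhds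
    have h2 : HasFDerivAt P _ x :=
      h1.add (hNC.eventually_hasFDerivAt.self_of_nhds.const_mul (-(K / R ^ 2)))
    have h3 := congrArg (fun D => D v) (hloc.hasFDerivAt_eq_zero h2)
    simp only [add_apply, smul_apply, fderiv_norm_sub_sq, real_inner_smul_left, smul_eq_mul,
      zero_apply, hneg] at h3
    rw [hd, real_inner_smul_left]
    field_simp at h3 ⊢
    linarith
  have hdn : ‖d‖ ≤ k * l ^ κ / R := by
    rw [hd, norm_smul, Real.norm_of_nonneg (by positivity)]
    calc 2 * (K / R ^ 2) / (κ - 1) * l ^ κ * ‖x - x₀‖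
        ≤ 2 * (K / R ^ 2) / (κ - 1) * l ^ κ * R := by gcongr
      _ = k * l ^ κ / R := by rw [hk]; field_simp
  have hell := ellOp_nonpos_of_isLocalMax b p hPC hloc
  rw [hP, hess_add hGC (contDiffAt_const.mul hNC), hess_const_mul hNC, ellOp_add, ellOp_smul,
    ellOp_hess_comp b p hCl hdl hG hG', ellOp_hess_norm_sub_sq, Fintype.card_fin] at hell
  have hlow := h.bernstein hx (hF l hl0)
  rw [hdl] at hlow
  have hup : ellOp b p (hess (logGrad u) x) ≤ κ * (k * l ^ κ / R) ^ 2 / l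
      + k * n * l ^ κ / R ^ 2 := by
    have e0 : ‖d‖ ^ 2 - inner ℝ d p ^ 2 / (1 + ‖p‖ ^ 2) ≤ (k * l ^ κ / R) ^ 2 := by
      have : 0 ≤ inner ℝ d p ^ 2 / (1 + ‖p‖ ^ 2) := by positivity
      have : ‖d‖ ^ 2 ≤ (k * l ^ κ / R) ^ 2 := by gcongr
      linarith
    have e1 : l ^ (-κ - 1) = (l ^ κ)⁻¹ / l := by
      rw [Real.rpow_sub_one hl0.ne', hneg]
    have e2 := card_sub_div_le n (‖p‖ ^ 2) (by positivity)
    rw [← hl, hneg, e1] at hell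
    generalize ‖d‖ ^ 2 - inner ℝ d p ^ 2 / (1 + ‖p‖ ^ 2) = α at *
    generalize ellOp b p (hess (logGrad u) x) = Λ at *
    generalize (n : ℝ) - ‖p‖ ^ 2 / (1 + ‖p‖ ^ 2) = ν at *
    have e3 : (κ - 1) * (l ^ κ)⁻¹ * Λ ≤ κ * (κ - 1) * ((l ^ κ)⁻¹ / l) * (k * l ^ κ / R) ^ 2
        + K / R ^ 2 * (2 * n) := by
      have f1 : κ * (κ - 1) * ((l ^ κ)⁻¹ / l) * α ≤
        κ * (κ - 1) * ((l ^ κ)⁻¹ / l) * (k * l ^ κ / R) ^ 2 := by gcongr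
      have f2 : K / R ^ 2 * (2 * ν) ≤ K / R ^ 2 * (2 * n) := by gcongr
      linarith
    have e4 : 0 < (κ - 1) * (l ^ κ)⁻¹ := by positivity
    refine le_of_mul_le_mul_left (e3.trans (le_of_eq ?_)) e4
    rw [hk]
    field_simp
  have hfin := superlinear_real_inequality hn (by linarith : 0 < κ) hδ hxl
    (Real.rpow_pos_of_pos hδ κ) (Real.rpow_le_rpow hδ.le hxl (by linarith)) (hCF l hxl).1
    (hCF l hxl).2 hC hk0 hR1 ((abs_inner_div_sqrt_le d p).trans hdn) hlow hup
  rw [← hM] at hfin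
  linarith [le_max_right 1 (M + 1)]

end Superlinear

/-! ### Subquadratic solutions with a sublinear power of the logarithm. -/

section Quadratic

variable {n : ℕ} {u : EuclideanSpace ℝ (Fin n) → ℝ}

theorem exists_abs_le_mul_sq_of_isLittleO (hu : Continuous u)
    (ho : Asymptotics.IsLittleO (Bornology.cobounded (EuclideanSpace ℝ (Fin n)))
        u (fun x => ‖x‖ ^ 2)) (x₀ : EuclideanSpace ℝ (Fin n)) {ε : ℝ} (hε : 0 < ε) :
    ∃ R₀, ∀ R, R₀ ≤ R → ∀ x ∈ Metric.closedBall x₀ R, |u x| ≤ ε * R ^ 2 := by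
  have h1 := ho.def (show 0 < ε / 4 by positivity)
  obtain ⟨ρ, -, hρ⟩ := (Filter.hasBasis_cobounded_norm.eventually_iff).1 h1
  obtain ⟨M, hM⟩ := ((isCompact_closedBall (0 : EuclideanSpace ℝ (Fin n)) ρ).image
    hu.abs).bddAbove
  refine ⟨max (max 1 ‖x₀‖) (M / ε), fun R hR x hx => ?_⟩
  have hR1 : 1 ≤ R := (le_max_left _ _).trans ((le_max_left _ _).trans hR)
  have hRx : ‖x₀‖ ≤ R := (le_max_right _ _).trans ((le_max_left _ _).trans hR)
  have hRM : M / ε ≤ R := (le_max_right _ _).trans hR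
  rw [div_le_iff₀ hε] at hRM
  rcases le_total ρ ‖x‖ with hx' | hx'
  · have h2 := hρ hx'
    simp only [Real.norm_eq_abs, abs_pow, abs_norm] at h2
    have h3 : ‖x‖ ≤ 2 * R := by
      have : ‖x - x₀‖ ≤ R := by simpa [dist_eq_norm] using hx
      have := norm_le_norm_add_norm_sub' x x₀
      linarith
    calc |u x| ≤ ε / 4 * ‖x‖ ^ 2 := h2
      _ ≤ ε / 4 * (2 * R) ^ 2 := by gcongr
      _ = ε * R ^ 2 := by ring
  · have h2 : |u x| ≤ M := hM ⟨x, by simpa using hx', rfl⟩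
    have : ε * R ≤ ε * R ^ 2 := by gcongr; exact le_self_pow₀ hR1 (by norm_num)
    linarith

/-- With `exp l = 1+|∇u|²`, the quotient on the right is `|∇u|²/√(1+|∇u|²)`, of order `exp(l/2)`.
Half of this exponent is spent absorbing `l^(1-θ) ≤ 4 exp(l/4)`. -/
theorem rpow_sub_one_mul_ge {θ δ l : ℝ} (hθ : 0 < θ) (hθ1 : θ ≤ 1) (hδ : 0 < δ) (hl : δ ≤ l) :
    (1 - Real.exp (-δ)) / 4 * Real.exp (l / 4)
      ≤ l ^ (θ - 1) * ((Real.exp l - 1) / Real.exp (l / 2)) := by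
  have hl0 : 0 < l := hδ.trans_le hl
  have h1 : l ^ (1 - θ) ≤ 4 * Real.exp (l / 4) := by
    have e1 : l ^ (1 - θ) ≤ (1 + l) ^ (1 - θ) :=
      Real.rpow_le_rpow hl0.le (by linarith) (by linarith)
    have e2 : (1 + l) ^ (1 - θ) ≤ (1 + l) ^ (1 : ℝ) :=
      Real.rpow_le_rpow_of_exponent_le (by linarith) (by linarith)
    rw [Real.rpow_one] at e2
    linarith [Real.add_one_le_exp (l / 4)]
  have h2 : l ^ (θ - 1) = (l ^ (1 - θ))⁻¹ := by
    rw [← Real.rpow_neg hl0.le]; congr 1; ring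
  have h3 : (4 * Real.exp (l / 4))⁻¹ ≤ l ^ (θ - 1) := by
    rw [h2]
    exact inv_anti₀ (Real.rpow_pos_of_pos hl0 _) h1
  have h4 : (1 - Real.exp (-δ)) * Real.exp (l / 2) ≤ (Real.exp l - 1) / Real.exp (l / 2) := by
    rw [le_div_iff₀ (Real.exp_pos _), mul_assoc, ← Real.exp_add, add_halves]
    have e1 : Real.exp (-l) * Real.exp l = 1 := by rw [← Real.exp_add]; simp
    have e2 : Real.exp (-l) ≤ Real.exp (-δ) := Real.exp_le_exp.2 (by linarith)
    have e3 := mul_le_mul_of_nonneg_right e2 (Real.exp_pos l).le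
    linarith
  have h5 : 0 ≤ 1 - Real.exp (-δ) := by
    have : Real.exp (-δ) ≤ 1 := Real.exp_le_one_iff.2 (by linarith)
    linarith
  calc (1 - Real.exp (-δ)) / 4 * Real.exp (l / 4)
      = (4 * Real.exp (l / 4))⁻¹ * ((1 - Real.exp (-δ)) * Real.exp (l / 2)) := by
        have : Real.exp (l / 2) = Real.exp (l / 4) * Real.exp (l / 4) := by
          rw [← Real.exp_add]; congr 1; ring
        rw [this]
        have := (Real.exp_pos (l / 4)).ne'
        field_simp
    _ ≤ _ := by gcongr

/-- Because `w/s = s - 1/s`, the main terms `λsF` cancel, leaving `2λF'w/s - λF/s`. Half of `F²/n`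
absorbs `λF/s`; the other half absorbs the cutoff drift `A` by completing a square. -/
theorem quadratic_real_inequality {n F F' w s lam ξ C A L : ℝ} (hn : 0 < n) (hF : 0 < F)
    (hF'0 : 0 ≤ F') (hF' : F' ≤ C * F) (hs : 1 ≤ s) (hsw : s ^ 2 = 1 + w)
    (hlam : lam ≤ F / (2 * n)) (hA : |A| ≤ 16 * ξ)
    (hlow : F ^ 2 / n + (F + 2 * F') * (lam * (w / s) + A) ≤ L)
    (hup : L ≤ lam * (s * F) + (16 * n + 32) * ξ ^ 2) :
    2 * lam * (F' * (w / s)) ≤ (128 * n * (1 + 2 * C) ^ 2 + 16 * n + 32) * ξ ^ 2 := by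
  have hws : w / s = s - 1 / s := by
    have : s ≠ 0 := by positivity
    field_simp
    linarith
  have h1 : lam * (F / s) ≤ F ^ 2 / (2 * n) := by
    calc lam * (F / s) ≤ F / (2 * n) * F := by
          gcongr
          exact div_le_self hF.le hs
      _ = _ := by ring
  have h2 : (F + 2 * F') * A ≥ -((1 + 2 * C) * F * (16 * ξ)) := by
    have e : |(F + 2 * F') * A| ≤ (1 + 2 * C) * F * (16 * ξ) := by
      rw [abs_mul, abs_of_nonneg (by positivity)]
      have e0 : F + 2 * F' ≤ (1 + 2 * C) * F := by linarith
      exact mul_le_mul e0 hA (abs_nonneg A) (by linarith)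
    linarith [neg_abs_le ((F + 2 * F') * A)]
  have h3 : (1 + 2 * C) * F * (16 * ξ) ≤ F ^ 2 / (2 * n) + 128 * n * (1 + 2 * C) ^ 2 * ξ ^ 2 := by
    have e : F ^ 2 / (2 * n) + 128 * n * (1 + 2 * C) ^ 2 * ξ ^ 2 - (1 + 2 * C) * F * (16 * ξ)
        = (F - 16 * n * (1 + 2 * C) * ξ) ^ 2 / (2 * n) := by
      field_simp
      ring
    have : 0 ≤ (F - 16 * n * (1 + 2 * C) * ξ) ^ 2 / (2 * n) := by positivity
    linarith
  have h4 : (F + 2 * F') * (lam * (w / s)) - lam * (s * F)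
      = 2 * lam * (F' * (w / s)) - lam * (F / s) := by
    have : F * (lam * (w / s)) = lam * (s * F) - lam * (F / s) := by rw [hws]; ring
    linear_combination this
  have h5 : F ^ 2 / n = F ^ 2 / (2 * n) + F ^ 2 / (2 * n) := by field_simp; ring
  rw [h5, mul_add] at hlow
  linarith

set_option maxHeartbeats 1000000 in
/-- Liouville theorem for a right-hand side `(log (1 + |∇u|²)) ^ θ`, `0 < θ ≤ 1`, and solutions of
subquadratic growth. -/
theorem IsEntireSolution.gradient_eq_zero_of_isLittleO_sq {θ : ℝ} (hθ : 0 < θ) (hθ1 : θ ≤ 1)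
    (h : IsEntireSolution (fun p => (Real.log (1 + ‖p‖ ^ 2)) ^ θ) u)
    (ho : Asymptotics.IsLittleO (Bornology.cobounded (EuclideanSpace ℝ (Fin n)))
        u (fun x => ‖x‖ ^ 2))
    (x₀ : EuclideanSpace ℝ (Fin n)) : gradient u x₀ = 0 := by
  by_contra hx₀
  have hn : (0 : ℝ) < n := by
    rcases Nat.eq_zero_or_pos n with h0 | h0
    · subst h0
      exact absurd (Subsingleton.elim _ _) hx₀
    · exact_mod_cast h0
  have hl₀ := logGrad_pos hx₀
  set δ := logGrad u x₀ / 2 with hδdef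
  have hδ : 0 < δ := by positivity
  set C := θ / δ with hC
  set C₃ := 128 * n * (1 + 2 * C) ^ 2 + 16 * n + 32 with hC₃
  have hC₃0 : 0 < C₃ := by positivity
  set c := 1 - Real.exp (-δ) with hc
  have hc0 : 0 < c := by
    have : Real.exp (-δ) < 1 := Real.exp_lt_one_iff.2 (by linarith)
    linarith
  -- Chosen so that the final lower bound is exactly twice the upper bound.
  set ε := δ * θ * c / (8 * C₃) with hε
  have hε0 : 0 < ε := by positivity
  have hδθ : 0 < δ ^ θ := Real.rpow_pos_of_pos hδ θ
  obtain ⟨R₀, hR₀⟩ := exists_abs_le_mul_sq_of_isLittleO h.contDiff_one.continuous ho x₀ hε0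
  -- The last entry makes `λ ≤ δ^θ/(2n)`, hence `λ ≤ F/(2n)` wherever `l ≥ δ`.
  set R := max (max 1 R₀) (δ / (2 * ε) * (2 * n) / δ ^ θ) with hR
  have hR1 : 1 ≤ R := (le_max_left _ _).trans (le_max_left _ _)
  have hR0 : 0 < R := by linarith
  have hRR₀ : R₀ ≤ R := (le_max_right _ _).trans (le_max_left _ _)
  have hRlam : δ / (2 * ε) * (2 * n) / δ ^ θ ≤ R := le_max_right _ _
  set lam := δ / (2 * ε) / R ^ 2 with hlam
  have hlam0 : 0 < lam := by positivity
  have hlam1 : lam ≤ δ ^ θ / (2 * n) := by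
    rw [div_le_iff₀ hδθ] at hRlam
    rw [hlam, div_le_div_iff₀ (by positivity) (by positivity)]
    calc δ / (2 * ε) * (2 * n) ≤ R * δ ^ θ := hRlam
      _ ≤ R ^ 2 * δ ^ θ := by gcongr; exact le_self_pow₀ hR1 (by norm_num)
      _ = δ ^ θ * R ^ 2 := by ring
  have hlamu : ∀ y ∈ Metric.closedBall x₀ R, |lam * u y| ≤ δ / 2 := by
    intro y hy
    rw [abs_mul, abs_of_pos hlam0]
    calc lam * |u y| ≤ lam * (ε * R ^ 2) := by gcongr; exact hR₀ R hRR₀ y hy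
      _ = δ / 2 := by rw [hlam]; field_simp
  set ζ : EuclideanSpace ℝ (Fin n) → ℝ := fun y => 1 - ‖y - x₀‖ ^ 2 / R ^ 2 with hζ
  set P : EuclideanSpace ℝ (Fin n) → ℝ :=
    fun y => (logGrad u y + -lam * u y) + 8 * Real.log (ζ y) with hP
  -- `Q = exp(P/8)` extends continuously by zero to the boundary sphere, so a positive maximum is
  -- interior and maximises `P` too.
  set Q : EuclideanSpace ℝ (Fin n) → ℝ :=
    fun y => ζ y * Real.exp ((logGrad u y + -lam * u y) / 8) with hQ
  have hPQ : ∀ y, 0 < ζ y → Q y = Real.exp (P y / 8) := by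
    intro y hy
    rw [hP, hQ, show ((logGrad u y + -lam * u y) + 8 * Real.log (ζ y)) / 8
      = Real.log (ζ y) + (logGrad u y + -lam * u y) / 8 by ring, Real.exp_add, Real.exp_log hy]
  have hcu := h.contDiff_one.continuous
  have hcl := h.continuous_logGrad
  have hζc : Continuous ζ := by fun_prop
  have hQc : Continuous Q := by fun_prop
  obtain ⟨x, hxball, hmax⟩ := (isCompact_closedBall x₀ R).exists_isMaxOn
    ⟨x₀, by simp [hR0.le]⟩ hQc.continuousOn
  have hx₀ball : x₀ ∈ Metric.closedBall x₀ R := by simp [hR0.le]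
  have hζ₀ : ζ x₀ = 1 := by simp [hζ]
  have hQx : 0 < Q x := by
    refine lt_of_lt_of_le ?_ (hmax hx₀ball)
    rw [hPQ x₀ (by rw [hζ₀]; norm_num)]
    positivity
  have hζx : 0 < ζ x := by
    by_contra! hneg
    have : Q x ≤ 0 := mul_nonpos_of_nonpos_of_nonneg hneg (Real.exp_pos _).le
    linarith
  have hxR : ‖x - x₀‖ < R := by
    have : ‖x - x₀‖ ^ 2 / R ^ 2 < 1 := by simp only [hζ] at hζx; linarith
    rw [div_lt_one (by positivity)] at this
    exact lt_of_pow_lt_pow_left₀ 2 hR0.le this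
  have hle : ∀ y ∈ Metric.closedBall x₀ R, 0 < ζ y → P y ≤ P x := by
    intro y hy hy'
    have : Q y ≤ Q x := hmax hy
    rw [hPQ y hy', hPQ x hζx, Real.exp_le_exp] at this
    linarith
  have hloc : IsLocalMax P x := by
    filter_upwards [Metric.isOpen_ball.mem_nhds (show x ∈ Metric.ball x₀ R by
      simpa [dist_eq_norm] using hxR), hζc.continuousAt.eventually (lt_mem_nhds hζx)] with y h1 h2
    exact hle y (Metric.ball_subset_closedBall h1) h2
  -- Comparison with `x₀`, where `l = 2δ`, costs at most `δ/2` for each value of `λu`. The weight 8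
  -- then yields `ζ⁻² ≤ exp(l/4)`, the rate that the gain can beat.
  have hxl : δ - 8 * Real.log (ζ x) ≤ logGrad u x := by
    have h1 := hle x₀ hx₀ball (by rw [hζ₀]; norm_num)
    simp only [hP, hζ₀, Real.log_one] at h1
    have h2 := abs_le.1 (hlamu x hxball)
    have h3 := abs_le.1 (hlamu x₀ hx₀ball)
    linarith [h2.1, h3.2]
  have hζ1 : ζ x ≤ 1 := by
    have : 0 ≤ ‖x - x₀‖ ^ 2 / R ^ 2 := by positivity
    simp only [hζ]
    linarith
  have hδl : δ ≤ logGrad u x := by linarith [Real.log_nonpos hζx.le hζ1]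
  have hl0 : 0 < logGrad u x := hδ.trans_le hδl
  have hx : gradient u x ≠ 0 := gradient_ne_zero_of_logGrad_pos hl0
  have hζexp : 1 / ζ x ^ 2 ≤ Real.exp (logGrad u x / 4) := by
    rw [div_le_iff₀ (by positivity), ← Real.exp_log (pow_pos hζx 2), ← Real.exp_add,
      Real.log_pow]
    apply Real.one_le_exp
    push_cast
    linarith
  have hCl := h.contDiffAt_logGrad hx
  have hCu : ContDiffAt ℝ 2 u x := (h.contDiffAt hx).of_le (by norm_num)
  have hNC : ContDiffAt ℝ 2 (fun y => ‖y - x₀‖ ^ 2) x := (contDiff_norm_sub_sq x₀).contDiffAt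
  have hexpl := exp_logGrad (u := u) x
  have hEq := h.ellOp_hess_eq hx
  set b := EuclideanSpace.basisFun (Fin n) ℝ with hb
  set p := gradient u x with hp
  set l := logGrad u x with hl
  set z := R ^ 2 * ζ x with hz
  have hz0 : 0 < z := by positivity
  have hzt : z = R ^ 2 - ‖x - x₀‖ ^ 2 := by rw [hz, hζ]; field_simp
  have hG : ∀ᶠ t in 𝓝 (‖x - x₀‖ ^ 2), HasDerivAt (fun t : ℝ => 8 * Real.log (1 - t / R ^ 2))
      (-8 / (R ^ 2 - t)) t := by
    filter_upwards [gt_mem_nhds (show ‖x - x₀‖ ^ 2 < R ^ 2 by linarith)] with t ht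
    have ht' : R ^ 2 - t ≠ 0 := by linarith
    have ht2 : 1 - t / R ^ 2 ≠ 0 := by
      have : 1 - t / R ^ 2 = (R ^ 2 - t) / R ^ 2 := by field_simp
      rw [this]
      positivity
    have := ((((hasDerivAt_id t).div_const (R ^ 2)).const_sub 1).log ht2).const_mul 8
    refine this.congr_deriv ?_
    simp only [id_eq]
    field_simp
  have hG' : HasDerivAt (fun t : ℝ => -8 / (R ^ 2 - t)) (-8 / z ^ 2) (‖x - x₀‖ ^ 2) := by
    have := (((hasDerivAt_id (‖x - x₀‖ ^ 2)).const_sub (R ^ 2)).fun_inv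
      (by simp only [id_eq, ← hzt]; exact hz0.ne')).const_mul (-8)
    simp only [id_eq, ← hzt] at this
    refine (this.congr_deriv ?_)
    field_simp
  have hGC : ContDiffAt ℝ 2 (fun y => 8 * Real.log (1 - ‖y - x₀‖ ^ 2 / R ^ 2)) x :=
    contDiffAt_const.mul ((contDiffAt_const.sub (hNC.div_const _)).log hζx.ne')
  have hLC : ContDiffAt ℝ 2 (fun y => logGrad u y + -lam * u y) x :=
    hCl.add (contDiffAt_const.mul hCu)
  have hPC : ContDiffAt ℝ 2 P x := hLC.add hGC
  set d := lam • p + (16 / z) • (x - x₀) with hd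
  have hdl : fderiv ℝ (logGrad u) x p = inner ℝ d p := by
    have h1 := hG.self_of_nhds.comp_hasFDerivAt x hNC.eventually_hasFDerivAt.self_of_nhds
    have h2 : HasFDerivAt P _ x := (hCl.eventually_hasFDerivAt.self_of_nhds.add
      (hCu.eventually_hasFDerivAt.self_of_nhds.const_mul (-lam))).add h1
    have h3 := congrArg (fun D => D p) (hloc.hasFDerivAt_eq_zero h2)
    simp only [add_apply, smul_apply, fderiv_norm_sub_sq, real_inner_smul_left, smul_eq_mul,
      zero_apply, fderiv_eq_inner_gradient u, ← hzt] at h3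
    rw [hd, inner_add_left, real_inner_smul_left, real_inner_smul_left]
    linear_combination h3
  have hell := ellOp_nonpos_of_isLocalMax b p hPC hloc
  have hPhess : hess P x = (hess (logGrad u) x + -lam • hess u x)
      + hess (fun y => 8 * Real.log (1 - ‖y - x₀‖ ^ 2 / R ^ 2)) x := by
    rw [hP, hζ, hess_add hLC hGC, hess_add hCl (contDiffAt_const.mul hCu), hess_const_mul hCu]
  rw [hPhess, ellOp_add, ellOp_add, ellOp_smul, hEq,
    ellOp_hess_comp b p hNC (fderiv_norm_sub_sq x₀ x) hG hG', ellOp_hess_norm_sub_sq,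
    Fintype.card_fin, ← hzt] at hell
  have hlow := h.bernstein (F := fun s => s ^ θ) hx (Real.hasDerivAt_rpow_const (Or.inl hl0.ne'))
  rw [hdl] at hlow
  set s := Real.sqrt (1 + ‖p‖ ^ 2) with hs
  have hs2 : s ^ 2 = 1 + ‖p‖ ^ 2 := Real.sq_sqrt (by positivity)
  have hs1 : 1 ≤ s := Real.one_le_sqrt.2 (by linarith [sq_nonneg ‖p‖])
  have hsexp : s = Real.exp (l / 2) := by
    rw [hs, ← hexpl, Real.exp_half]
  set ξ := R / z with hξ
  have hξ0 : 0 < ξ := by positivity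
  have hξ2 : ξ ^ 2 ≤ Real.exp (l / 4) / R ^ 2 := by
    calc ξ ^ 2 = 1 / ζ x ^ 2 / R ^ 2 := by rw [hξ, hz]; field_simp
      _ ≤ _ := by gcongr
  have hup : ellOp b p (hess (logGrad u) x) ≤ lam * (s * l ^ θ) + (16 * n + 32) * ξ ^ 2 := by
    have e0 : ‖(2 : ℝ) • (x - x₀)‖ ^ 2 - inner ℝ ((2 : ℝ) • (x - x₀)) p ^ 2 / (1 + ‖p‖ ^ 2)
        ≤ 4 * R ^ 2 := by
      have f1 : 0 ≤ inner ℝ ((2 : ℝ) • (x - x₀)) p ^ 2 / (1 + ‖p‖ ^ 2) := by positivity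
      have f2 : ‖(2 : ℝ) • (x - x₀)‖ ^ 2 = 4 * ‖x - x₀‖ ^ 2 := by
        rw [norm_smul, Real.norm_ofNat]; ring
      have f3 : ‖x - x₀‖ ^ 2 ≤ R ^ 2 := by gcongr
      linarith
    have e2 := card_sub_div_le n (‖p‖ ^ 2) (by positivity)
    generalize ‖(2 : ℝ) • (x - x₀)‖ ^ 2 - inner ℝ ((2 : ℝ) • (x - x₀)) p ^ 2 / (1 + ‖p‖ ^ 2) = α at *
    generalize (n : ℝ) - ‖p‖ ^ 2 / (1 + ‖p‖ ^ 2) = ν at *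
    have f1 : 8 / z * (2 * ν) ≤ 16 * n * ξ ^ 2 := by
      calc 8 / z * (2 * ν) ≤ 8 / z * (2 * n) := by gcongr
        _ = 16 * n * (1 / z) := by ring
        _ ≤ 16 * n * ξ ^ 2 := by
          gcongr
          rw [hξ, div_pow, div_le_div_iff₀ hz0 (by positivity)]
          have : z ≤ R ^ 2 := by rw [hzt]; linarith [sq_nonneg ‖x - x₀‖]
          nlinarith
    have f2 : 8 / z ^ 2 * α ≤ 32 * ξ ^ 2 := by
      calc 8 / z ^ 2 * α ≤ 8 / z ^ 2 * (4 * R ^ 2) := by gcongr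
        _ = 32 * ξ ^ 2 := by rw [hξ, div_pow, ← mul_div_assoc, div_mul_eq_mul_div]; ring_nf
    have g1 : -8 / z * (2 * ν) = -(8 / z * (2 * ν)) := by ring
    have g2 : -8 / z ^ 2 * α = -(8 / z ^ 2 * α) := by ring
    have g3 : Real.log (1 + ‖p‖ ^ 2) = l := rfl
    rw [g1, g2, g3] at hell
    linarith
  have hA : |inner ℝ ((16 / z) • (x - x₀)) p / s| ≤ 16 * ξ := by
    refine (abs_inner_div_sqrt_le _ p).trans ?_
    rw [norm_smul, Real.norm_of_nonneg (by positivity)]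
    calc 16 / z * ‖x - x₀‖ ≤ 16 / z * R := by gcongr
      _ = 16 * ξ := by rw [hξ]; ring
  have hds : inner ℝ d p / s = lam * (‖p‖ ^ 2 / s) + inner ℝ ((16 / z) • (x - x₀)) p / s := by
    rw [hd, inner_add_left, real_inner_smul_left p p, real_inner_self_eq_norm_sq]
    ring
  rw [hds] at hlow
  have hlθ : 0 < l ^ θ := Real.rpow_pos_of_pos hl0 θ
  have hF' : θ * l ^ (θ - 1) ≤ C * l ^ θ := by
    rw [Real.rpow_sub_one hl0.ne', hC]
    calc θ * (l ^ θ / l) ≤ θ * (l ^ θ / δ) := by gcongr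
      _ = _ := by ring
  have hlamF : lam ≤ l ^ θ / (2 * n) :=
    hlam1.trans (by gcongr)
  have hmain := quadratic_real_inequality hn hlθ
    (mul_nonneg hθ.le (Real.rpow_pos_of_pos hl0 _).le) hF' hs1 hs2 hlamF hA hlow hup
  rw [← hC₃] at hmain
  have hw : ‖p‖ ^ 2 = Real.exp l - 1 := by rw [hexpl]; ring
  have hge := rpow_sub_one_mul_ge hθ hθ1 hδ hδl
  rw [← hsexp, ← hw, ← hc] at hge
  have h1 : 2 * lam * (θ * (c / 4 * Real.exp (l / 4))) ≤ C₃ * (Real.exp (l / 4) / R ^ 2) := by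
    calc 2 * lam * (θ * (c / 4 * Real.exp (l / 4)))
        ≤ 2 * lam * (θ * (l ^ (θ - 1) * (‖p‖ ^ 2 / s))) := by gcongr
      _ = 2 * lam * (θ * l ^ (θ - 1) * (‖p‖ ^ 2 / s)) := by ring
      _ ≤ C₃ * ξ ^ 2 := hmain
      _ ≤ _ := by gcongr
  have h2 : 2 * lam * (θ * (c / 4 * Real.exp (l / 4))) = 2 * (C₃ * (Real.exp (l / 4) / R ^ 2)) := by
    rw [hlam, hε]
    field_simp
    norm_num
  have h3 : 0 < C₃ * (Real.exp (l / 4) / R ^ 2) := by positivity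
  linarith

end Quadratic

/-! ### Comparison with radial barriers. -/

section Barrier

variable {n : ℕ} {u : EuclideanSpace ℝ (Fin n) → ℝ}

/-- Strict supersolution property of the barrier, with the factor `δ` removed. For `r ≥ n` the
gradient term `2qr` already covers `2nq`, and concavity of the profile gives strictness. For `r < n`
the singular part dominates, `q ≤ 2KZ`, and the small slope `w ≤ 1` lets the concave term win. -/
theorem barrier_real_inequality {n t r Z K w q : ℝ} (hn : 1 ≤ n) (hr : 0 < r) (ht : t = r ^ 2)
    (hZ : 0 < Z) (hK : 0 < K) (hw : 0 ≤ w) (hq : q = 1 + K * Z)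
    (hsmall : r < n → 1 ≤ K * Z ∧ w ≤ 1) :
    4 * (-(K * (2 * n + 1) * (Z / t))) * (t / (1 + w)) + q * (2 * (n - w / (1 + w)))
      < 2 * q * r := by
  have ht0 : 0 < t := by rw [ht]; positivity
  have hKZ : 0 < K * Z := by positivity
  have hq0 : 0 < q := by rw [hq]; positivity
  have e1 : 4 * (-(K * (2 * n + 1) * (Z / t))) * (t / (1 + w))
      = -(4 * (2 * n + 1) * (K * Z) / (1 + w)) := by field_simp
  have e2 : q * (2 * (n - w / (1 + w))) ≤ q * (2 * n) := by
    gcongr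
    have : 0 ≤ w / (1 + w) := by positivity
    linarith
  have e3 : 0 < 4 * (2 * n + 1) * (K * Z) / (1 + w) := by positivity
  rw [e1]
  rcases lt_or_ge r n with h | h
  · obtain ⟨h1, h2⟩ := hsmall h
    have h3 : 2 * (2 * n + 1) * (K * Z) ≤ 4 * (2 * n + 1) * (K * Z) / (1 + w) := by
      rw [le_div_iff₀ (by positivity)]
      have : 0 < 2 * (2 * n + 1) * (K * Z) := by positivity
      nlinarith
    have h4 : q * (2 * n) ≤ 2 * (K * Z) * (2 * n) := by
      gcongr
      linarith
    have h5 : 0 < 2 * q * r := by positivity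
    nlinarith
  · have : q * (2 * n) ≤ 2 * q * r := by nlinarith
    linarith

/-- Liouville theorem for the right-hand side `|∇u| / √(1 + |∇u|²)` and solutions of subquadratic
growth, by comparison with radial barriers. -/
theorem IsEntireSolution.le_of_isLittleO_sq
    (h : IsEntireSolution (fun p => ‖p‖ / Real.sqrt (1 + ‖p‖ ^ 2)) u)
    (ho : Asymptotics.IsLittleO (Bornology.cobounded (EuclideanSpace ℝ (Fin n)))
        u (fun x => ‖x‖ ^ 2))
    (x₁ x₀ : EuclideanSpace ℝ (Fin n)) : u x₁ ≤ u x₀ := by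
  by_contra! hlt
  have hne : x₁ ≠ x₀ := fun he => by simp [he] at hlt
  have hn : (1 : ℝ) ≤ n := by
    rcases Nat.eq_zero_or_pos n with h0 | h0
    · subst h0
      exact absurd (Subsingleton.elim _ _) hne
    · exact_mod_cast h0
  have hn0 : (0 : ℝ) < n := by linarith
  have hcu := h.contDiff_one.continuous
  set m := (u x₀ + u x₁) / 2 with hm
  obtain ⟨r₀, hr₀, hr₀u⟩ : ∃ r₀ > 0, ∀ y, ‖y - x₀‖ ≤ r₀ → u y < m := by
    have h1 : ∀ᶠ y in 𝓝 x₀, u y < m := hcu.continuousAt.eventually (gt_mem_nhds (by linarith))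
    obtain ⟨r, hr, hr'⟩ := Metric.nhds_basis_closedBall.eventually_iff.1 h1
    exact ⟨r, hr, fun y hy => hr' (by simpa [dist_eq_norm] using hy)⟩
  have hr₀x₁ : r₀ < ‖x₁ - x₀‖ := by
    by_contra! hle
    have := hr₀u x₁ hle
    linarith
  set N : ℤ := 2 * n with hN
  -- Makes the singular part `K t^(-N-1)` of `φ'` at least 1 for `t = r²`, `r < n`.
  set K : ℝ := (n : ℝ) ^ (2 * (N + 1)) with hK
  have hK0 : 0 < K := by positivity
  set φ : ℝ → ℝ := fun t => t - K / (2 * n) * t ^ (-N) with hφ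
  set φ' : ℝ → ℝ := fun t => 1 + K * t ^ (-N - 1) with hφ'
  have dφ : ∀ t, 0 < t → HasDerivAt φ (φ' t) t := by
    intro t ht
    have := (hasDerivAt_id t).sub ((hasDerivAt_zpow (-N) t (Or.inl ht.ne')).const_mul (K / (2 * n)))
    refine this.congr_deriv ?_
    simp only [hφ', hN]
    push_cast
    field_simp
    ring
  have dφ' : ∀ t, 0 < t → HasDerivAt φ' (-(K * (2 * n + 1) * (t ^ (-N - 1) / t))) t := by
    intro t ht
    have := ((hasDerivAt_zpow (-N - 1) t (Or.inl ht.ne')).const_mul K).const_add 1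
    refine this.congr_deriv ?_
    rw [zpow_sub_one₀ ht.ne' (-N - 1), hN]
    push_cast
    ring
  set q₀ := 1 + K * (r₀ ^ 2) ^ (-N - 1) with hq₀
  have hq₀0 : 0 < q₀ := by positivity
  have hφ'q₀ : ∀ t, r₀ ^ 2 ≤ t → φ' t ≤ q₀ := by
    intro t ht
    simp only [hφ', hq₀]
    gcongr
    have e : -N - 1 = -((2 * n + 1 : ℕ) : ℤ) := by rw [hN]; push_cast; ring
    rw [e, zpow_neg, zpow_neg, zpow_natCast, zpow_natCast]
    gcongr
  set Δ := |φ (‖x₁ - x₀‖ ^ 2) - φ (r₀ ^ 2)| + 1 with hΔ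
  have hΔ0 : 0 < Δ := by positivity
  -- The first bound keeps the barrier's slope at most 1 for `r₀ ≤ r < n`; the second makes `P` on
  -- the inner sphere smaller than `P x₁`.
  set δ := min (1 / (2 * q₀ * n)) ((u x₁ - m) / Δ / 2) with hδ
  have hum : 0 < u x₁ - m := by linarith
  have hδ0 : 0 < δ := lt_min (by positivity) (by positivity)
  have hδ1 : 2 * δ * q₀ * n ≤ 1 := by
    have : δ ≤ 1 / (2 * q₀ * n) := min_le_left _ _
    rw [le_div_iff₀ (by positivity)] at this
    linarith
  have hδ2 : δ * (φ (‖x₁ - x₀‖ ^ 2) - φ (r₀ ^ 2)) < u x₁ - m := by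
    have h1 : δ ≤ (u x₁ - m) / Δ / 2 := min_le_right _ _
    calc δ * (φ (‖x₁ - x₀‖ ^ 2) - φ (r₀ ^ 2)) ≤ δ * Δ := by
          gcongr
          linarith [le_abs_self (φ (‖x₁ - x₀‖ ^ 2) - φ (r₀ ^ 2))]
      _ ≤ (u x₁ - m) / Δ / 2 * Δ := by gcongr
      _ = (u x₁ - m) / 2 := by field_simp
      _ < u x₁ - m := by linarith
  set P : EuclideanSpace ℝ (Fin n) → ℝ := fun y => u y + -δ * φ (‖y - x₀‖ ^ 2) with hP
  -- With `δ/2` in place of `δ`, the barrier exceeds `u` by about `δR²/2` on the outer sphere, so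
  -- the maximum is not there either.
  obtain ⟨R₀, hR₀⟩ := exists_abs_le_mul_sq_of_isLittleO hcu ho x₀ (half_pos hδ0)
  obtain ⟨R, hRR₀, hRx₁, hR1, hRP⟩ : ∃ R, R₀ ≤ R ∧ ‖x₁ - x₀‖ ≤ R ∧ 1 ≤ R ∧
      δ / 2 * R ^ 2 - δ * φ (R ^ 2) < P x₁ := by
    have h1 : Tendsto (fun R : ℝ => δ / 2 * R ^ 2) atTop atTop :=
      (tendsto_pow_atTop (by norm_num)).const_mul_atTop (half_pos hδ0)
    obtain ⟨R, h2, h3, h4, h5⟩ := ((h1.eventually_gt_atTop (δ * (K / (2 * n)) - P x₁)).and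
      ((eventually_ge_atTop R₀).and ((eventually_ge_atTop ‖x₁ - x₀‖).and
        (eventually_ge_atTop 1)))).exists
    refine ⟨R, h3, h4, h5, ?_⟩
    have h6 : (R ^ 2) ^ (-N) ≤ 1 := by
      have e : -N = -((2 * n : ℕ) : ℤ) := by rw [hN]; push_cast; ring
      rw [e, zpow_neg, zpow_natCast]
      exact inv_le_one_of_one_le₀ (one_le_pow₀ (one_le_pow₀ h5))
    have h7 : δ * (K / (2 * n)) * (R ^ 2) ^ (-N) ≤ δ * (K / (2 * n)) * 1 := by gcongr
    simp only [hφ]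
    linarith
  have hφc : ContinuousOn φ (Set.Ioi 0) := fun t ht => (dφ t ht).continuousAt.continuousWithinAt
  have hpos : ∀ y, r₀ ≤ ‖y - x₀‖ → 0 < ‖y - x₀‖ ^ 2 := fun y hy => by
    have : 0 < ‖y - x₀‖ := hr₀.trans_le hy
    positivity
  obtain ⟨x, ⟨hxR, hxr⟩, hmax⟩ : ∃ x ∈ Metric.closedBall x₀ R ∩ {y | r₀ ≤ ‖y - x₀‖},
      IsMaxOn P (Metric.closedBall x₀ R ∩ {y | r₀ ≤ ‖y - x₀‖}) x := by
    have hclosed : IsClosed {y : EuclideanSpace ℝ (Fin n) | r₀ ≤ ‖y - x₀‖} :=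
      isClosed_le continuous_const (by fun_prop)
    refine ((isCompact_closedBall x₀ R).inter_right hclosed).exists_isMaxOn
      ⟨x₁, by simpa [dist_eq_norm] using hRx₁, hr₀x₁.le⟩ ?_
    refine hcu.continuousOn.add (continuousOn_const.mul ?_)
    exact hφc.comp (by fun_prop) fun y hy => hpos y hy.2
  have hxR : ‖x - x₀‖ ≤ R := by simpa [dist_eq_norm] using hxR
  have hxr : r₀ ≤ ‖x - x₀‖ := hxr
  have hPx : P x₁ ≤ P x := hmax ⟨by simpa [dist_eq_norm] using hRx₁, hr₀x₁.le⟩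
  have hxr' : r₀ < ‖x - x₀‖ := by
    refine lt_of_le_of_ne hxr fun he => ?_
    have h1 := hr₀u x he.ge
    simp only [hP, ← he] at hPx
    linarith
  have hxR' : ‖x - x₀‖ < R := by
    refine lt_of_le_of_ne hxR fun he => ?_
    have h1 := (le_abs_self _).trans (hR₀ R hRR₀ x (by simpa [dist_eq_norm] using hxR))
    have h2 : P x = u x + -δ * φ (R ^ 2) := by simp only [hP, he]
    linarith
  have hloc : IsLocalMax P x := by
    refine hmax.isLocalMax ?_
    have hc : Continuous fun y : EuclideanSpace ℝ (Fin n) => ‖y - x₀‖ := by fun_prop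
    filter_upwards [hc.continuousAt.eventually (lt_mem_nhds hxr'),
      hc.continuousAt.eventually (gt_mem_nhds hxR')] with y h1 h2
    exact ⟨by simpa [dist_eq_norm] using h2.le, h1.le⟩
  set r := ‖x - x₀‖ with hr
  have hr0 : 0 < r := hr₀.trans hxr'
  have ht0 : 0 < r ^ 2 := by positivity
  have hNC : ContDiffAt ℝ 2 (fun y => ‖y - x₀‖ ^ 2) x := (contDiff_norm_sub_sq x₀).contDiffAt
  set Z := (r ^ 2) ^ (-N - 1) with hZ
  have hZ0 : 0 < Z := by positivity
  set q := φ' (r ^ 2) with hq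
  have hq0 : 0 < q := by positivity
  have hp : gradient u x = (2 * δ * q) • (x - x₀) := by
    have h1 := (dφ _ ht0).comp_hasFDerivAt x hNC.eventually_hasFDerivAt.self_of_nhds
    have hud := (h.contDiff_one.differentiable (by norm_num) x).hasFDerivAt
    have h2 : HasFDerivAt P _ x := hud.add (h1.const_mul (-δ))
    refine ext_inner_right ℝ fun v => ?_
    have h3 := congrArg (fun D => D v) (hloc.hasFDerivAt_eq_zero h2)
    simp only [add_apply, smul_apply, fderiv_norm_sub_sq, real_inner_smul_left, smul_eq_mul,
      zero_apply, fderiv_eq_inner_gradient u] at h3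
    rw [real_inner_smul_left]
    linear_combination h3
  have hpn : ‖gradient u x‖ = 2 * δ * q * r := by
    rw [hp, norm_smul, Real.norm_of_nonneg (by positivity)]
  -- The barrier has no critical point away from `x₀`, so at the contact point `u` is smooth and
  -- satisfies the equation.
  have hx : gradient u x ≠ 0 := by
    rw [← norm_pos_iff, hpn]
    positivity
  have hCu : ContDiffAt ℝ 2 u x := (h.contDiffAt hx).of_le (by norm_num)
  have hφC : ContDiffAt ℝ 2 (fun y => φ (‖y - x₀‖ ^ 2)) x := by
    refine hNC.sub (contDiffAt_const.mul ?_)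
    have e : -N = -((2 * n : ℕ) : ℤ) := by rw [hN]; push_cast; ring
    simp only [e, zpow_neg, zpow_natCast]
    exact (hNC.pow _).inv (by positivity)
  have hPC : ContDiffAt ℝ 2 P x := hCu.add (contDiffAt_const.mul hφC)
  set b := EuclideanSpace.basisFun (Fin n) ℝ with hb
  have hell := ellOp_nonpos_of_isLocalMax b (gradient u x) hPC hloc
  have hG : ∀ᶠ s in 𝓝 (‖x - x₀‖ ^ 2), HasDerivAt φ (φ' s) s := by
    filter_upwards [lt_mem_nhds ht0] with s hs using dφ s hs
  rw [hP, hess_add hCu (contDiffAt_const.mul hφC), hess_const_mul hφC, ellOp_add, ellOp_smul,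
    h.ellOp_hess_eq hx, ellOp_hess_comp b _ hNC (fderiv_norm_sub_sq x₀ x) hG (dφ' _ ht0),
    ellOp_hess_norm_sub_sq, Fintype.card_fin] at hell
  set w := ‖gradient u x‖ ^ 2 with hw
  have hw0 : 0 ≤ w := by positivity
  have e1 : Real.sqrt (1 + w) * (‖gradient u x‖ / Real.sqrt (1 + w)) = 2 * δ * q * r := by
    rw [← hpn]
    have : Real.sqrt (1 + w) ≠ 0 := (Real.sqrt_pos.2 (by positivity)).ne'
    field_simp
  -- Here `∇u` is parallel to `x - x₀`, so the quadratic form is evaluated in the direction where it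
  -- equals `1/(1+w)`.
  have e2 : ‖(2 : ℝ) • (x - x₀)‖ ^ 2 - inner ℝ ((2 : ℝ) • (x - x₀)) (gradient u x) ^ 2 / (1 + w)
      = 4 * (r ^ 2 / (1 + w)) := by
    have f1 : inner ℝ ((2 : ℝ) • (x - x₀)) (gradient u x) ^ 2 = 4 * r ^ 2 * w := by
      rw [hw, hpn, hp, real_inner_smul_left, real_inner_smul_right, real_inner_self_eq_norm_sq]
      ring
    rw [f1, norm_smul, Real.norm_ofNat]
    field_simp
    ring
  rw [e1, e2] at hell
  have hbar := barrier_real_inequality (n := n) (t := r ^ 2) (r := r) (Z := Z) (K := K) (w := w)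
    (q := q) hn hr0 rfl hZ0 hK0 hw0 rfl (by
      intro hrn
      constructor
      · have e : -N - 1 = -((2 * n + 1 : ℕ) : ℤ) := by rw [hN]; push_cast; ring
        have e' : 2 * (N + 1) = ((2 * (2 * n + 1) : ℕ) : ℤ) := by rw [hN]; push_cast; ring
        rw [hZ, hK, e, e', zpow_neg, zpow_natCast, zpow_natCast, ← div_eq_mul_inv,
          one_le_div (by positivity), ← pow_mul]
        gcongr
      · have f1 : 2 * δ * q * r ≤ 2 * δ * q₀ * n := by
          gcongr
          exact hφ'q₀ _ (by gcongr)
        rw [hw, hpn]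
        exact pow_le_one₀ (by positivity) (f1.trans hδ1))
  have := mul_lt_mul_of_pos_left hbar hδ0
  linarith

end Barrier

/-! ### Growth conditions for the specific right-hand sides. -/

section Conclusion

variable {n : ℕ} {u : EuclideanSpace ℝ (Fin n) → ℝ}

theorem IsEntireSolution.gradient_eq_zero_of_rpow {θ : ℝ} (hθ : 0 < θ)
    (h : IsEntireSolution (fun p => ‖p‖ ^ θ) u) (x : EuclideanSpace ℝ (Fin n)) :
    gradient u x = 0 := by
  have hf : (fun p : EuclideanSpace ℝ (Fin n) => ‖p‖ ^ θ)
      = fun p => (fun l => (Real.exp l - 1) ^ (θ / 2)) (Real.log (1 + ‖p‖ ^ 2)) := by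
    funext p
    simp only
    rw [Real.exp_log (by positivity), add_sub_cancel_left, ← Real.rpow_natCast ‖p‖ 2,
      ← Real.rpow_mul (norm_nonneg p)]
    congr 1
    push_cast
    ring
  rw [hf] at h
  have hpos : ∀ l : ℝ, 0 < l → 0 < Real.exp l - 1 := fun l hl => by
    linarith [Real.add_one_lt_exp hl.ne']
  -- In terms of `l` the power is `(exp l - 1)^(θ/2)`, which grows exponentially; `κ = 2` is merely
  -- a convenient exponent above 1.
  refine h.gradient_eq_zero_of_superlinear (F := fun l => (Real.exp l - 1) ^ (θ / 2)) (κ := 2)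
    (F' := fun l => θ / 2 * ((Real.exp l - 1) ^ (θ / 2) / (Real.exp l - 1) * Real.exp l))
    (fun l hl => ?_) one_lt_two (fun δ hδ => ?_) x
  · have := ((Real.hasDerivAt_exp l).sub_const 1).rpow_const (p := θ / 2) (Or.inl (hpos l hl).ne')
    refine this.congr_deriv ?_
    rw [Real.rpow_sub_one (hpos l hl).ne']
    ring
  · have hd := hpos δ hδ
    set a := 1 - Real.exp (-δ) with ha
    have ha0 : 0 < a := by
      have : Real.exp (-δ) < 1 := Real.exp_lt_one_iff.2 (by linarith)
      linarith
    have hquot : ∀ l, δ ≤ l → a * Real.exp l ≤ Real.exp l - 1 := by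
      intro l hl
      have e1 : Real.exp (-l) * Real.exp l = 1 := by rw [← Real.exp_add]; simp
      have e2 : Real.exp (-l) ≤ Real.exp (-δ) := Real.exp_le_exp.2 (by linarith)
      have e3 := mul_le_mul_of_nonneg_right e2 (Real.exp_pos l).le
      rw [ha]
      linarith
    have haθ : 0 < a ^ (θ / 2) := Real.rpow_pos_of_pos ha0 _
    set C₁ := 32 / θ ^ 2 / a ^ (θ / 2) with hC₁
    set C₂ := θ / 2 / a with hC₂
    have hC₁0 : 0 < C₁ := by positivity
    have hC₂0 : 0 < C₂ := by positivity
    refine ⟨C₁ + C₂, by positivity, fun l hl => ?_⟩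
    have hl0 : 0 < l := hδ.trans_le hl
    have hF0 : 0 < (Real.exp l - 1) ^ (θ / 2) := Real.rpow_pos_of_pos (hpos l hl0) _
    constructor
    · have h1 : (a * Real.exp l) ^ (θ / 2) ≤ (Real.exp l - 1) ^ (θ / 2) :=
        Real.rpow_le_rpow (by positivity) (hquot l hl) (by positivity)
      rw [Real.mul_rpow ha0.le (Real.exp_pos l).le, ← Real.exp_mul] at h1
      have h2 : (l * (θ / 2)) ^ 2 / 2 ≤ Real.exp (l * (θ / 2)) := by
        have := Real.quadratic_le_exp_of_nonneg (x := l * (θ / 2)) (by positivity)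
        have : 0 < l * (θ / 2) := by positivity
        linarith
      have h3 : l ^ 2 ≤ C₁ * (Real.exp l - 1) ^ (θ / 2) := by
        calc l ^ 2 ≤ C₁ * (a ^ (θ / 2) * ((l * (θ / 2)) ^ 2 / 2)) := by
              have e : C₁ * (a ^ (θ / 2) * ((l * (θ / 2)) ^ 2 / 2)) = 4 * l ^ 2 := by
                rw [hC₁]
                field_simp
                norm_num
              rw [e]
              nlinarith [sq_nonneg l]
          _ ≤ C₁ * (a ^ (θ / 2) * Real.exp (l * (θ / 2))) := by gcongr
          _ ≤ _ := by gcongr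
      rw [Real.rpow_two]
      nlinarith
    · rw [abs_of_nonneg (by have := hpos l hl0; positivity)]
      have h1 : θ / 2 * ((Real.exp l - 1) ^ (θ / 2) / (Real.exp l - 1) * Real.exp l)
          ≤ C₂ * (Real.exp l - 1) ^ (θ / 2) := by
        have e : Real.exp l / (Real.exp l - 1) ≤ 1 / a := by
          rw [div_le_div_iff₀ (hpos l hl0) ha0]
          linarith [hquot l hl]
        calc θ / 2 * ((Real.exp l - 1) ^ (θ / 2) / (Real.exp l - 1) * Real.exp l)
            = θ / 2 * (Real.exp l - 1) ^ (θ / 2) * (Real.exp l / (Real.exp l - 1)) := by ring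
          _ ≤ θ / 2 * (Real.exp l - 1) ^ (θ / 2) * (1 / a) := by gcongr
          _ = _ := by rw [hC₂]; ring
      nlinarith

theorem IsEntireSolution.gradient_eq_zero_of_log_rpow {θ : ℝ} (hθ : 1 < θ)
    (h : IsEntireSolution (fun p => (Real.log (1 + ‖p‖ ^ 2)) ^ θ) u)
    (x : EuclideanSpace ℝ (Fin n)) : gradient u x = 0 := by
  refine IsEntireSolution.gradient_eq_zero_of_superlinear (F := fun l => l ^ θ) (κ := θ)
    (F' := fun l => θ * l ^ (θ - 1))
    (fun l hl => Real.hasDerivAt_rpow_const (Or.inl hl.ne')) hθ (fun δ hδ => ?_) h x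
  refine ⟨1 + θ / δ, by positivity, fun l hl => ?_⟩
  have hl0 : 0 < l := hδ.trans_le hl
  have hlθ : 0 < l ^ θ := Real.rpow_pos_of_pos hl0 θ
  have hθδ : 0 < θ / δ * l ^ θ := by positivity
  constructor
  · linarith
  · rw [abs_of_nonneg (by positivity), Real.rpow_sub_one hl0.ne']
    have : θ * (l ^ θ / l) ≤ θ * (l ^ θ / δ) := by gcongr
    have e : θ * (l ^ θ / δ) = θ / δ * l ^ θ := by ring
    linarith

theorem isLittleO_sq_of_isLittleO_rpow
    (ho : Asymptotics.IsLittleO (Bornology.cobounded (EuclideanSpace ℝ (Fin n)))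
      u (fun x => ‖x‖ ^ (1 / 3 : ℝ))) :
    Asymptotics.IsLittleO (Bornology.cobounded (EuclideanSpace ℝ (Fin n)))
      u (fun x => ‖x‖ ^ 2) := by
  refine ho.trans_isBigO (Asymptotics.IsBigO.of_bound 1 ?_)
  filter_upwards [tendsto_norm_cobounded_atTop.eventually_ge_atTop 1] with x hx
  rw [Real.norm_of_nonneg (by positivity), Real.norm_of_nonneg (by positivity), one_mul,
    ← Real.rpow_natCast ‖x‖ 2]
  exact Real.rpow_le_rpow_of_exponent_le hx (by norm_num)

end Conclusion

theorem mainTheorem2 (n : ℕ) (u : EuclideanSpace ℝ (Fin n) → ℝ) :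
    -- (E1)
    (∀ θ : ℝ, 0 < θ →
      IsEntireSolution (fun p => ‖p‖ ^ θ) u →
      ∃ c : ℝ, ∀ x, u x = c) ∧
    -- (E2)
    (∀ θ : ℝ, 1 < θ →
      IsEntireSolution (fun p => (Real.log (1 + ‖p‖ ^ 2)) ^ θ) u →
      ∃ c : ℝ, ∀ x, u x = c) ∧
    -- (E3)
    (∀ θ : ℝ, 0 < θ → θ ≤ 1 →
      IsEntireSolution (fun p => (Real.log (1 + ‖p‖ ^ 2)) ^ θ) u →
      Asymptotics.IsLittleO (Bornology.cobounded (EuclideanSpace ℝ (Fin n)))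
        u (fun x => ‖x‖ ^ 2) →
      ∃ c : ℝ, ∀ x, u x = c) ∧
    -- (E4)
    (IsEntireSolution (fun p => ‖p‖ / Real.sqrt (1 + ‖p‖ ^ 2)) u →
      Asymptotics.IsLittleO (Bornology.cobounded (EuclideanSpace ℝ (Fin n)))
        u (fun x => ‖x‖ ^ (1 / 3 : ℝ)) →
      ∃ c : ℝ, ∀ x, u x = c) := by
  refine ⟨fun θ hθ h => ?_, fun θ hθ h => ?_, fun θ hθ hθ1 h ho => ?_, fun h ho => ?_⟩
  · exact exists_eq_const_of_gradient_eq_zero (h.contDiff_one.differentiable (by norm_num))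
      (h.gradient_eq_zero_of_rpow hθ)
  · exact exists_eq_const_of_gradient_eq_zero (h.contDiff_one.differentiable (by norm_num))
      (h.gradient_eq_zero_of_log_rpow hθ)
  · exact exists_eq_const_of_gradient_eq_zero (h.contDiff_one.differentiable (by norm_num))
      (h.gradient_eq_zero_of_isLittleO_sq hθ hθ1 ho)
  · have ho' := isLittleO_sq_of_isLittleO_rpow ho
    exact ⟨u 0, fun x => le_antisymm (h.le_of_isLittleO_sq ho' x 0) (h.le_of_isLittleO_sq ho' 0 x)⟩
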